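/- Let $\Gamma$ be an ADE Dynkin diagram ($A_n$ with $n\ge 1$, $D_n$ with $n\ge 4$, $E_6$, $E_7$ or $E_8$) with vertices $1,\dots,n$ and adjacency matrix $Ad_\Gamma$. Let $W$ be its Coxeter group with simple reflections $s_i$ and Coxeter matrix $m$. Let $\gamma=\gamma^+\gamma^-$ be its distinguished Coxeter element, where $\gamma^+$ (resp. $\gamma^-$) is the product of the commuting $s_k$ over the vertices $k$ at even (resp. odd) distance from the first vertex, a fixed end vertex of $\Gamma$, and let the Coxeter number $h$ be the order of $\gamma$ in $W$ (all Coxeter elements of $W$ have this order). Let $V_\Gamma=\bigoplus_i\mathbb R\alpha_i$ and $M_\Gamma=\bigoplus_i\mathbb Z\alpha_i$, and let $\mathfrak A=(-2\cos(\pi/m(i,j)))_{i,j}$ be the Cartan matrix, so that $2I-\mathfrak A=Ad_\Gamma$. The Coxeter plane $P_\Gamma\subseteq V_\Gamma$ is the span of the eigenvectors of $2I-\mathfrak A$ for the eigenvalues $2\cos(\pi/h)$ and $-2\cos(\pi/h)$. Let $\Delta_0=1$, $\Delta_1=x$, $\Delta_k=x\Delta_{k-1}-\Delta_{k-2}$ in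 $\mathbb Z[x]$, let $R_{h-1}=\mathbb Z[x]/(\Delta_{h-1})$ be the Verlinde ring, and let $R_{h-1}^{\mathrm{even}}\subseteq R_{h-1}$ be the subring generated by the $\Delta_{2k}$ with $0\le k\le\lfloor (h-2)/2\rfloor$. A fusion ring is a ring with a finite $\mathbb Z$-basis $\{b_i\}$ that contains $b_0=1$, with structure constants in $\mathbb Z_{\ge0}$, and with an involution $i\mapsto i^*$ that extends to an anti-automorphism and for which the coefficient of $b_0$ in $b_ib_j$ is $1$ if $i=j^*$ and $0$ otherwise; $\mathrm{FPdim}(b_i)$ is the largest real eigenvalue of the matrix of left multiplication by $b_i$. A $\mathbb Z_+$-module over it is a module with a fixed $\mathbb Z$-basis on which each $b_i$ acts by a matrix with entries in $\mathbb Z_{\ge0}$. A hypergroup is an $\mathbb R$-algebra with a finite basis $\{r_i\}$ that contains $r_0=1$, with structure constants $N_{ij}^k\ge0$ such that $\sum_kN_{ij}^k=1$, and with an involution $i\mapsto i^*$ that extends to an anti-automorphism and for which $N_{ij}^0=N_{ji}^0$, and $N_{ij}^0>0$ if and only if $j=i^*$. A fixed point of an action $\Theta$ of a hypergroup, i.e.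 of an $\mathbb R$-algebra homomorphism $\Theta$ to $\mathrm{Mat}_n(\mathbb R)$, is a vector $v\in\mathbb R^n$ with $\Theta(r_i)v=v$ for all $i$. Then $R_{h-1}$ is a fusion ring with basis $\{\Delta_k\}_{0\le k\le h-2}$, and $R_{h-1}^{\mathrm{even}}$ is one with basis $\{\Delta_{2k}\}_{0\le k\le\lfloor(h-2)/2\rfloor}$. The algebra $R_{h-1}^{\mathrm{even}}\otimes\mathbb R$ is a hypergroup with basis $\{\Delta_{2k}/\mathrm{FPdim}(\Delta_{2k})\}$, with $\mathrm{FPdim}$ taken in $R_{h-1}^{\mathrm{even}}$. There is a (unique) $R_{h-1}$-module structure on $M_\Gamma$ for which $\Delta_1$ acts by $Ad_\Gamma$, and it makes $M_\Gamma$ a $\mathbb Z_+$-module with basis $\{\alpha_i\}$. The subspace of fixed points of the induced action of the hypergroup $R_{h-1}^{\mathrm{even}}\otimes\mathbb R$ on $V_\Gamma=M_\Gamma\otimes\mathbb R$ is exactly the Coxeter plane $P_\Gamma$. Moreover, the eigenspaces of $2I-\mathfrak A$ for $2\cos(\pi/h)$ and for $-2\cos(\pi/h)$ are one-dimensional, and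 $P_\Gamma$ has dimension $2$ if $n\ge2$ (for $A_1$ we have $h=2$ and $P_\Gamma=V_\Gamma$ is a line). -/

import Mathlib

open scoped TensorProduct

noncomputable section

/-- The ADE Dynkin diagrams: `A n` for `n ≥ 1`, `D n` for `n ≥ 4`, and `E6`, `E7`, `E8`. -/
inductive ADEDiagram : Type
  | A (n : ℕ) (hn : 1 ≤ n)
  | D (n : ℕ) (hn : 4 ≤ n)
  | E6
  | E7
  | E8

namespace ADEDiagram

/-- The number of vertices. -/
def rank : ADEDiagram → ℕ
  | A n _ => n
  | D n _ => n
  | E6 => 6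
  | E7 => 7
  | E8 => 8

/-- The edges of the diagram, on vertices numbered from `0`, each listed once with its smaller
endpoint first. Vertex `j > 0` is a leaf of the subtree on `{0, ..., j}`. In type `D` the branch
vertex is `1`, with neighbours `0`, `2`, `3`; in type `E` with `r` vertices, there is a path
`0, ..., r - 2` and the last vertex `r - 1` is attached to `r - 4`. -/
def Edge : ADEDiagram → ℕ → ℕ → Prop
  | A _ _, i, j => j = i + 1
  | D _ _, i, j => (j = i + 1 ∧ j ≠ 3) ∨ (i = 1 ∧ j = 3)
  | E6, i, j => (j = i + 1 ∧ j ≠ 5) ∨ (i = 2 ∧ j = 5)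
  | E7, i, j => (j = i + 1 ∧ j ≠ 6) ∨ (i = 3 ∧ j = 6)
  | E8, i, j => (j = i + 1 ∧ j ≠ 7) ∨ (i = 4 ∧ j = 7)

instance (Γ : ADEDiagram) (i j : ℕ) : Decidable (Γ.Edge i j) := by
  cases Γ <;> unfold Edge <;> infer_instance

/-- The diagram as a simple graph. -/
def graph (Γ : ADEDiagram) : SimpleGraph (Fin Γ.rank) :=
  SimpleGraph.fromRel fun i j => Γ.Edge i j

instance (Γ : ADEDiagram) : DecidableRel Γ.graph.Adj := fun i j =>
  decidable_of_iff (i ≠ j ∧ (Γ.Edge i j ∨ Γ.Edge j i))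
    (SimpleGraph.fromRel_adj (fun i j : Fin Γ.rank => Γ.Edge i j) i j).symm

theorem rank_pos (Γ : ADEDiagram) : 0 < Γ.rank := by
  cases Γ <;> simp only [rank] <;> omega

/-- The first vertex. -/
def root (Γ : ADEDiagram) : Fin Γ.rank := ⟨0, Γ.rank_pos⟩

/-- The Coxeter matrix of the diagram: all edges are unlabelled, i.e. stand for `m(i, j) = 3`. -/
def coxeterMatrix (Γ : ADEDiagram) : CoxeterMatrix (Fin Γ.rank) where
  M := Matrix.of fun i j => if i = j then 1 else if Γ.graph.Adj i j then 3 else 2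
  isSymm := by
    ext i j
    simp [eq_comm, SimpleGraph.adj_comm]
  diagonal := by simp
  off_diagonal := by
    intro i j hij
    simp only [Matrix.of_apply, if_neg hij]
    split_ifs <;> norm_num

/-- The Coxeter group `W` of the diagram, given by the Coxeter presentation. -/
abbrev W (Γ : ADEDiagram) : Type := Γ.coxeterMatrix.Group

/-- The product of the simple reflections `s_k`, over the vertices `k` at even distance from the
first vertex (these commute with one another). -/
def gammaPlus (Γ : ADEDiagram) : Γ.W :=
  (((List.finRange Γ.rank).filter fun k => Even (Γ.graph.dist k Γ.root)).map
    Γ.coxeterMatrix.simple).prod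

/-- The product of the simple reflections `s_k`, over the vertices `k` at odd distance from the
first vertex (these commute with one another). -/
def gammaMinus (Γ : ADEDiagram) : Γ.W :=
  (((List.finRange Γ.rank).filter fun k => Odd (Γ.graph.dist k Γ.root)).map
    Γ.coxeterMatrix.simple).prod

/-- The distinguished Coxeter element `γ = γ⁺ γ⁻` of `W`. -/
def coxeterElement (Γ : ADEDiagram) : Γ.W := Γ.gammaPlus * Γ.gammaMinus

/-- The Coxeter number `h`: the order in `W` of the distinguished Coxeter element. (All Coxeter
elements of `W` are conjugate, so any other one has the same order.) -/
def coxeterNumber (Γ : ADEDiagram) : ℕ := orderOf Γ.coxeterElement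

/-- The Cartan matrix `𝔄`, with entries `⟨α_i | α_j⟩ = -2 cos (π / m(i, j))`. -/
def cartanMatrix (Γ : ADEDiagram) : Matrix (Fin Γ.rank) (Fin Γ.rank) ℝ :=
  Matrix.of fun i j => -2 * Real.cos (Real.pi / (Γ.coxeterMatrix i j : ℝ))

/-- The geometric representation space `V_Γ`, in coordinates for the basis `α_i` of simple roots;
the lattice `M_Γ` spanned by the `α_i` is `Fin Γ.rank → ℤ`. -/
abbrev V (Γ : ADEDiagram) : Type := Fin Γ.rank → ℝ

/-- The eigenspace of `2 I - 𝔄`, acting on `V_Γ`, for the number `t`. -/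
def eigenspace (Γ : ADEDiagram) (t : ℝ) : Submodule ℝ Γ.V :=
  Module.End.eigenspace
    (Matrix.toLin' ((2 : ℝ) • (1 : Matrix (Fin Γ.rank) (Fin Γ.rank) ℝ) - Γ.cartanMatrix)) t

/-- The Coxeter plane: the span of the eigenvectors of `2 I - 𝔄` for the eigenvalues
`2 cos (π / h)` and `-2 cos (π / h)`. -/
def coxeterPlane (Γ : ADEDiagram) : Submodule ℝ Γ.V :=
  Γ.eigenspace (2 * Real.cos (Real.pi / (Γ.coxeterNumber : ℝ))) ⊔
    Γ.eigenspace (-(2 * Real.cos (Real.pi / (Γ.coxeterNumber : ℝ))))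

end ADEDiagram

/-- The structure of a fusion ring on a ring `R`: a finite `ℤ`-basis `b_i` that contains `1`, with
structure constants in `ℤ₊`, and an involution `*` of the index set that extends to an
anti-automorphism of `R` and for which the coefficient of `1` in `b_i b_j` is `1` if `i = j*`, and
`0` otherwise. -/
structure FusionRing (R : Type) [Ring R] (I : Type) [Fintype I] [DecidableEq I] where
  basis : Module.Basis I ℤ R
  unit : I
  star : I → I
  basis_unit : basis unit = 1
  nonneg : ∀ i j k, 0 ≤ basis.repr (basis i * basis j) k
  star_star : ∀ i, star (star i) = i
  star_anti : ∃ φ : R ≃+* Rᵐᵒᵖ, ∀ i, φ (basis i) = MulOpposite.op (basis (star i))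
  unit_coeff : ∀ i j, basis.repr (basis i * basis j) unit = if i = star j then 1 else 0

namespace FusionRing

variable {R : Type} [Ring R] {I : Type} [Fintype I] [DecidableEq I]

/-- The matrix `N_i` of left multiplication by `b_i`, in the basis `b`. -/
def leftMulMatrix (F : FusionRing R I) (i : I) : Matrix I I ℤ :=
  Matrix.of fun k j => F.basis.repr (F.basis i * F.basis j) k

/-- The Frobenius-Perron dimension of `b_i`: the largest real eigenvalue of the non-negative matrix
`N_i`. -/
def FPdim (F : FusionRing R I) (i : I) : ℝ :=
  sSup {t : ℝ | Module.End.HasEigenvalue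
    (Matrix.toLin' ((F.leftMulMatrix i).map (Int.cast : ℤ → ℝ))) t}

/-- A left `R`-module structure on `ℤ^ι`, given by `ρ`, is a `ℤ₊`-module (for the standard basis)
if each `b_i` acts by a matrix with entries in `ℤ₊`. -/
def IsZPlusModule (F : FusionRing R I) {ι : Type} [Fintype ι] [DecidableEq ι]
    (ρ : R →+* Matrix ι ι ℤ) : Prop :=
  ∀ i k l, 0 ≤ ρ (F.basis i) k l

end FusionRing

/-- The structure of a (finite) hypergroup on an `ℝ`-algebra `A`: a finite basis `r_i` that contains
`1`, whose structure constants `N_{ij}^k` are non-negative with `∑ k, N_{ij}^k = 1`, and an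
involution `*` of the index set that extends to an anti-automorphism of `A`, such that
`N_{ij}^0 = N_{ji}^0`, and `N_{ij}^0 > 0` if and only if `j = i*`. -/
structure Hypergroup (A : Type) [Ring A] [Algebra ℝ A] (I : Type) [Fintype I] where
  basis : Module.Basis I ℝ A
  unit : I
  star : I → I
  basis_unit : basis unit = 1
  nonneg : ∀ i j k, 0 ≤ basis.repr (basis i * basis j) k
  sum_eq_one : ∀ i j, ∑ k, basis.repr (basis i * basis j) k = 1
  star_star : ∀ i, star (star i) = i
  star_anti : ∃ φ : A ≃ₐ[ℝ] Aᵐᵒᵖ, ∀ i, φ (basis i) = MulOpposite.op (basis (star i))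
  unit_coeff_comm : ∀ i j,
    basis.repr (basis i * basis j) unit = basis.repr (basis j * basis i) unit
  unit_coeff_pos : ∀ i j, 0 < basis.repr (basis i * basis j) unit ↔ j = star i

/-- The subspace of fixed points of an action `Θ` of a hypergroup on `ℝ^ι`: the vectors fixed by
`Θ (r_i)` for all basis elements `r_i`. -/
def Hypergroup.fixedPoints {A : Type} [Ring A] [Algebra ℝ A] {I : Type} [Fintype I]
    (H : Hypergroup A I) {ι : Type} [Fintype ι] [DecidableEq ι] (Θ : A →ₐ[ℝ] Matrix ι ι ℝ) :
    Submodule ℝ (ι → ℝ) where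
  carrier := {v | ∀ i, (Θ (H.basis i)).mulVec v = v}
  zero_mem' := by simp
  add_mem' := by
    intro v w hv hw i
    rw [Matrix.mulVec_add, hv i, hw i]
  smul_mem' := by
    intro c v hv i
    rw [Matrix.mulVec_smul, hv i]

/-- The extension of scalars to `ℝ` of an action of a ring `R` on `ℤ^ι`: the action of `ℝ ⊗ R` on
`ℝ^ι` in which `c ⊗ x` acts by `c • ρ x`. -/
def extendScalars {R : Type} [Ring R] {ι : Type} [Fintype ι] [DecidableEq ι]
    (ρ : R →+* Matrix ι ι ℤ) : ℝ ⊗[ℤ] R →ₐ[ℝ] Matrix ι ι ℝ :=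
  Algebra.TensorProduct.lift (Algebra.ofId ℝ (Matrix ι ι ℝ))
    (((Int.castRingHom ℝ).mapMatrix.comp ρ).toIntAlgHom)
    (fun c _ => Algebra.commutes c _)

theorem extendScalars_tmul {R : Type} [Ring R] {ι : Type} [Fintype ι] [DecidableEq ι]
    (ρ : R →+* Matrix ι ι ℤ) (c : ℝ) (x : R) :
    extendScalars ρ (c ⊗ₜ[ℤ] x) = c • (ρ x).map (Int.cast : ℤ → ℝ) :=
  (Algebra.TensorProduct.lift_tmul _ _ _ _ _).trans
    (Algebra.smul_def c ((ρ x).map (Int.cast : ℤ → ℝ))).symm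

/-- The Verlinde ring `R_n = ℤ[x] / (Δ_n(x))`, where `Δ_k` is the normalised Chebyshev polynomial of
the second kind: `Δ_0 = 1`, `Δ_1 = x`, `Δ_k = x Δ_{k-1} - Δ_{k-2}`. -/
abbrev VerlindeRing (n : ℕ) : Type := AdjoinRoot (Polynomial.Chebyshev.S ℤ (n : ℤ))

/-- The class of `Δ_k` in `R_n`. -/
def verlindeDelta (n k : ℕ) : VerlindeRing n :=
  AdjoinRoot.mk (Polynomial.Chebyshev.S ℤ (n : ℤ)) (Polynomial.Chebyshev.S ℤ (k : ℤ))

/-- The even part of `R_n`: the subring generated by the `Δ_{2k}` with `0 ≤ k ≤ ⌊(n - 1) / 2⌋`. -/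
def verlindeEven (n : ℕ) : Subring (VerlindeRing n) :=
  Subring.closure {x | ∃ k : ℕ, k ≤ (n - 1) / 2 ∧ x = verlindeDelta n (2 * k)}

end

/-! Everything follows from one fact about the adjacency matrix `A` of the diagram: for the
appropriate `h` it has a strictly positive eigenvector `v` with eigenvalue `t = 2 cos (π / h)`, on a
connected bipartite graph (`HasPerronVector`). Only this fact is checked diagram by diagram, with `h
= n + 1`, `2n - 2`, `12`, `18`, `30`; that `h` is the Coxeter number is then deduced from it.

Let `W` act on `V_Γ` by reflections. Every root is positive or negative, and the action is faithful.
For the bipartite colouring, the reflection in all vertices of one colour sends `x + y` to `x + (A x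
- y)`, where `y` is supported on that colour and `x` on the other. This is the Chebyshev recurrence,
with two consequences.

First, the vectors `Δ_k(A) α_i + Δ_{k-1}(A) α_i` are roots. For `k < h` their pairing with `v` is
positive, because `Δ_k(t) sin (π / h) = sin ((k + 1) π / h)`. So they are positive roots, and since
the two summands live on different colours, `Δ_k(A)` has non-negative entries. For `k = h - 1` the
pairing of `v` with the columns vanishes, so `Δ_{h-1}(A) = 0`. Hence `M_Γ` is a `ℤ₊`-module over the
Verlinde ring (`chebMatrix_nonneg`, `chebMatrix_pred_eq_zero`).

Second, the Coxeter element shifts solutions of the recurrence by two steps. The vanishing of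
`Δ_{h-1}(A)` makes these solutions `2h`-periodic, so the order divides `h`; comparing sines on the
two colour parts of `v` shows that it is exactly `h` (`coxeterNumber_eq`).

The fusion rings are the case of the path `A_n` with `n = h - 1`: its first vertex generates the
regular representation, so structure constants are entries of `Δ_k` of the path. A positive
character computes `FPdim`, so `FPdim (Δ_{2k}) = Δ_{2k}(t)`.

Finally, the Coxeter plane is the `t²`-eigenspace of `A²` (`mem_coxeterPlane_iff`). Each `Δ_{2k}` is
a polynomial in `x²`, so it acts on the plane by `Δ_{2k}(t)`; conversely `Δ_2 = x² - 1` alone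
recovers the condition on `A²`. Multiplicity one is the Perron-Frobenius argument, and changing
signs on one colour exchanges `t` and `-t`. -/

noncomputable section
-- The geometric representation of the Coxeter group and its faithfulness
namespace ADEDiagram

open Matrix

variable (Γ : ADEDiagram)

/-- The linear form `⟨α_i | ·⟩` on `V_Γ`. -/
def rootForm (i : Fin Γ.rank) : Γ.V →ₗ[ℝ] ℝ :=
  (2 : ℝ) • LinearMap.proj i - LinearMap.proj i ∘ₗ Matrix.mulVecLin (Γ.graph.adjMatrix ℝ)

theorem rootForm_apply (i : Fin Γ.rank) (v : Γ.V) :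
    Γ.rootForm i v = 2 * v i - (Γ.graph.adjMatrix ℝ *ᵥ v) i := by
  simp [rootForm]

theorem rootForm_single (i j : Fin Γ.rank) :
    Γ.rootForm i (Pi.single j 1) = if i = j then 2 else if Γ.graph.Adj i j then -1 else 0 := by
  rw [rootForm_apply, Matrix.mulVec_single_one]
  by_cases hij : i = j
  · subst hij
    simp
  · by_cases h : Γ.graph.Adj i j <;> simp [hij, h]

/-- The reflection in the simple root `α_i`. -/
def simpleReflection (i : Fin Γ.rank) : Module.End ℝ Γ.V :=
  1 - (Γ.rootForm i).smulRight (Pi.single i 1)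

theorem simpleReflection_apply (i : Fin Γ.rank) (v : Γ.V) :
    Γ.simpleReflection i v = v - Γ.rootForm i v • Pi.single i 1 := by
  simp [simpleReflection]

theorem simpleReflection_single_self (i : Fin Γ.rank) :
    Γ.simpleReflection i (Pi.single i 1) = -Pi.single i 1 := by
  rw [simpleReflection_apply, rootForm_single, if_pos rfl]
  module

theorem simpleReflection_single_of_adj {i j : Fin Γ.rank} (h : Γ.graph.Adj i j) :
    Γ.simpleReflection i (Pi.single j 1) = Pi.single j 1 + Pi.single i 1 := by
  rw [simpleReflection_apply, rootForm_single, if_neg h.ne, if_pos h]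
  module

theorem simpleReflection_single_of_not_adj {i j : Fin Γ.rank} (hij : i ≠ j)
    (h : ¬Γ.graph.Adj i j) :
    Γ.simpleReflection i (Pi.single j 1) = Pi.single j 1 := by
  rw [simpleReflection_apply, rootForm_single, if_neg hij, if_neg h]
  module

theorem coxeterMatrix_of_adj {i j : Fin Γ.rank} (h : Γ.graph.Adj i j) :
    Γ.coxeterMatrix i j = 3 := by
  change (if i = j then 1 else if Γ.graph.Adj i j then 3 else 2) = 3
  rw [if_neg h.ne, if_pos h]

theorem coxeterMatrix_of_not_adj {i j : Fin Γ.rank} (hij : i ≠ j) (h : ¬Γ.graph.Adj i j) :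
    Γ.coxeterMatrix i j = 2 := by
  change (if i = j then 1 else if Γ.graph.Adj i j then 3 else 2) = 2
  rw [if_neg hij, if_neg h]

/-- A word in two simple reflections changes a vector only by multiples of the two simple roots,
with coefficients governed by the pairings `2`, `-1` and `0`; each Coxeter relation is thus a linear
identity. -/
theorem isLiftable_simpleReflection : Γ.coxeterMatrix.IsLiftable Γ.simpleReflection := by
  intro i j
  refine LinearMap.ext fun v => ?_
  by_cases hij : i = j
  · subst hij
    rw [Γ.coxeterMatrix.diagonal, pow_one]
    simp only [Module.End.mul_apply, simpleReflection_apply, map_sub, map_smul, rootForm_single,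
      if_pos, Module.End.one_apply]
    module
  · by_cases h : Γ.graph.Adj i j
    · rw [coxeterMatrix_of_adj Γ h]
      simp only [pow_succ, pow_zero, one_mul, Module.End.mul_apply, simpleReflection_apply,
        map_sub, map_smul, rootForm_single, if_pos, if_neg hij, if_neg (Ne.symm hij), if_pos h,
        if_pos h.symm, Module.End.one_apply]
      module
    · have h' : ¬Γ.graph.Adj j i := fun h' => h h'.symm
      rw [coxeterMatrix_of_not_adj Γ hij h]
      simp only [pow_succ, pow_zero, one_mul, Module.End.mul_apply, simpleReflection_apply,
        map_sub, map_smul, rootForm_single, if_pos, if_neg hij, if_neg (Ne.symm hij), if_neg h,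
        if_neg h', Module.End.one_apply]
      module

/-- The tautological Coxeter system on `W`. -/
abbrev coxeterSystem : CoxeterSystem Γ.coxeterMatrix Γ.W := Γ.coxeterMatrix.toCoxeterSystem

/-- The geometric representation of `W` on `V_Γ`. -/
def geomRep : Γ.W →* Module.End ℝ Γ.V :=
  Γ.coxeterSystem.lift ⟨Γ.simpleReflection, Γ.isLiftable_simpleReflection⟩

theorem geomRep_simple (i : Fin Γ.rank) :
    Γ.geomRep (Γ.coxeterSystem.simple i) = Γ.simpleReflection i :=
  Γ.coxeterSystem.lift_apply_simple Γ.isLiftable_simpleReflection i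

theorem geomRep_simple_single_self (i : Fin Γ.rank) :
    Γ.geomRep (Γ.coxeterSystem.simple i) (Pi.single i 1) = -Pi.single i 1 := by
  rw [geomRep_simple, simpleReflection_single_self]

/-- If `w` is shorter than `w s_i`, then `w α_i` is a positive root. -/
theorem geomRep_single_nonneg (w : Γ.W) (i : Fin Γ.rank)
    (hw : Γ.coxeterSystem.length w < Γ.coxeterSystem.length (w * Γ.coxeterSystem.simple i)) :
    0 ≤ Γ.geomRep w (Pi.single i 1) := by
  induction hn : Γ.coxeterSystem.length w using Nat.strong_induction_on generalizing w i with
  | _ n ih =>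
  subst hn
  set cs := Γ.coxeterSystem with hcs
  rcases eq_or_ne w 1 with rfl | hw1
  · simp
  obtain ⟨j, hj⟩ := cs.exists_rightDescent_of_ne_one hw1
  have hij : j ≠ i := by
    rintro rfl
    exact lt_asymm hj hw
  obtain ⟨v, rfl⟩ : ∃ v, w = v * cs.simple j := ⟨w * cs.simple j, by simp⟩
  have hv : cs.length v + 1 = cs.length (v * cs.simple j) := by
    have := cs.length_mul_simple v j
    simp only [CoxeterSystem.IsRightDescent, CoxeterSystem.simple_mul_simple_cancel_right] at hj
    omega
  by_cases hadj : Γ.graph.Adj j i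
  · have key : Γ.geomRep (v * cs.simple j) (Pi.single i 1) =
        Γ.geomRep v (Pi.single i 1) + Γ.geomRep v (Pi.single j 1) := by
      rw [map_mul, Module.End.mul_apply, geomRep_simple,
        simpleReflection_single_of_adj Γ hadj, map_add]
    have hvj : 0 ≤ Γ.geomRep v (Pi.single j 1) := ih _ (by omega) v j (by omega) rfl
    rcases cs.length_mul_simple v i with hvi | hvi
    · rw [key]
      exact add_nonneg (ih _ (by omega) v i (by omega) rfl) hvj
    · obtain ⟨u, rfl⟩ : ∃ u, v = u * cs.simple i := ⟨v * cs.simple i, by simp⟩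
      rw [CoxeterSystem.simple_mul_simple_cancel_right] at hvi
      have key2 : Γ.geomRep (u * cs.simple i * cs.simple j) (Pi.single i 1) =
          Γ.geomRep u (Pi.single j 1) := by
        rw [key, map_mul, Module.End.mul_apply, Module.End.mul_apply, geomRep_simple_single_self,
          geomRep_simple, simpleReflection_single_of_adj Γ hadj.symm, map_add, map_neg]
        abel
      rw [key2]
      refine ih _ (by omega) u j ?_ rfl
      -- With `w = u s_i s_j`, the braid relation gives `w s_i = u s_j s_i s_j`. If `u s_j` were
      -- shorter than `u`, this would have length at most `ℓ(u) + 1`, while `ℓ(w) = ℓ(u) + 2` and `w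
      -- s_i` is longer still.
      have braid : cs.simple i * cs.simple j * cs.simple i =
          cs.simple j * cs.simple i * cs.simple j := by
        have h3 := cs.simple_mul_simple_pow i j
        rw [coxeterMatrix_of_adj Γ hadj.symm] at h3
        have : cs.simple i * cs.simple j * cs.simple i *
          (cs.simple j * cs.simple i * cs.simple j) = 1 := by
          rw [← h3]; simp only [pow_succ, pow_zero, one_mul, mul_assoc]
        rw [mul_eq_one_iff_eq_inv] at this
        rw [this]
        simp [mul_assoc]
      have hb : u * cs.simple i * cs.simple j * cs.simple i =
          u * cs.simple j * cs.simple i * cs.simple j := by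
        rw [mul_assoc u, mul_assoc u, braid]; simp only [mul_assoc]
      rw [hb] at hw
      have h1 := cs.length_mul_simple (u * cs.simple j * cs.simple i) j
      have h2 := cs.length_mul_simple (u * cs.simple j) i
      have h3 := cs.length_mul_simple u j
      omega
  · have key : Γ.geomRep (v * cs.simple j) (Pi.single i 1) = Γ.geomRep v (Pi.single i 1) := by
      rw [map_mul, Module.End.mul_apply, geomRep_simple,
        simpleReflection_single_of_not_adj Γ hij hadj]
    rw [key]
    refine ih _ (by omega) v i ?_ rfl
    -- If `v s_i` were shorter than `v`, then `w s_i = v s_i s_j` would have length at most `ℓ(v)`,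
    -- which is less than `ℓ(w)`.
    have comm : cs.simple j * cs.simple i = cs.simple i * cs.simple j := by
      have h2 := cs.simple_mul_simple_pow j i
      rw [coxeterMatrix_of_not_adj Γ hij hadj, pow_two, mul_eq_one_iff_eq_inv] at h2
      rw [h2]
      simp
    rw [mul_assoc, comm, ← mul_assoc] at hw
    have h1 := cs.length_mul_simple (v * cs.simple i) j
    have h3 := cs.length_mul_simple v i
    omega

/-- Every root is positive or negative. -/
theorem geomRep_single_nonneg_or_nonpos (w : Γ.W) (i : Fin Γ.rank) :
    0 ≤ Γ.geomRep w (Pi.single i 1) ∨ Γ.geomRep w (Pi.single i 1) ≤ 0 := by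
  rcases Γ.coxeterSystem.length_mul_simple w i with h | h
  · exact Or.inl (Γ.geomRep_single_nonneg w i (by omega))
  · right
    have := Γ.geomRep_single_nonneg (w * Γ.coxeterSystem.simple i) i (by
      rw [CoxeterSystem.simple_mul_simple_cancel_right]; omega)
    rw [map_mul, Module.End.mul_apply, geomRep_simple_single_self, map_neg] at this
    simpa using this

/-- If `w ≠ 1` acts trivially and `i` is a right descent of `w`, then `w s_i` sends `α_i` to `-α_i`;
but `w s_i` is shorter than `w`, so this image must be non-negative. -/
theorem geomRep_injective : Function.Injective Γ.geomRep := by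
  refine (injective_iff_map_eq_one _).2 fun w hw => ?_
  by_contra hw1
  obtain ⟨i, hi⟩ := Γ.coxeterSystem.exists_rightDescent_of_ne_one hw1
  have := Γ.geomRep_single_nonneg (w * Γ.coxeterSystem.simple i) i (by
    rw [CoxeterSystem.simple_mul_simple_cancel_right]; exact hi)
  rw [map_mul, Module.End.mul_apply, geomRep_simple_single_self, hw] at this
  have := this i
  simp at this
  linarith

/-! ### Reflections in all vertices of one colour -/

/-- The product of the simple reflections in the vertices of colour `b`, for a proper colouring
`c`. -/
def colorReflection (c : Fin Γ.rank → Bool) (b : Bool) : Module.End ℝ Γ.V where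
  toFun v k := if c k = b then (Γ.graph.adjMatrix ℝ *ᵥ v) k - v k else v k
  map_add' v w := by
    ext k
    simp only [Matrix.mulVec_add, Pi.add_apply]
    split_ifs <;> ring
  map_smul' r v := by
    ext k
    simp only [Matrix.mulVec_smul, Pi.smul_apply, smul_eq_mul, RingHom.id_apply]
    split_ifs <;> ring

theorem colorReflection_apply (c : Fin Γ.rank → Bool) (b : Bool) (v : Γ.V) (k : Fin Γ.rank) :
    Γ.colorReflection c b v k = if c k = b then (Γ.graph.adjMatrix ℝ *ᵥ v) k - v k else v k := rfl

theorem simpleReflection_apply_self (i : Fin Γ.rank) (v : Γ.V) :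
    Γ.simpleReflection i v i = (Γ.graph.adjMatrix ℝ *ᵥ v) i - v i := by
  simp [simpleReflection_apply, rootForm_apply]
  ring

theorem simpleReflection_apply_of_ne {i k : Fin Γ.rank} (h : k ≠ i) (v : Γ.V) :
    Γ.simpleReflection i v k = v k := by
  simp [simpleReflection_apply, h]

/-- Each `s_i` changes only coordinate `i`, using only the neighbours of `i`. As no two vertices of
the list are adjacent, earlier changes do not influence later ones. -/
theorem geomRep_prod_map_simple (l : List (Fin Γ.rank)) (hl : l.Nodup)
    (hadj : ∀ i ∈ l, ∀ j ∈ l, ¬Γ.graph.Adj i j) (v : Γ.V) (k : Fin Γ.rank) :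
    Γ.geomRep (l.map Γ.coxeterMatrix.simple).prod v k =
      if k ∈ l then (Γ.graph.adjMatrix ℝ *ᵥ v) k - v k else v k := by
  induction l generalizing k with
  | nil => simp
  | cons a l ih =>
    rw [List.nodup_cons] at hl
    have ih' := ih hl.2 fun i hi j hj => hadj i (List.mem_cons_of_mem _ hi) j
      (List.mem_cons_of_mem _ hj)
    rw [List.map_cons, List.prod_cons, map_mul, Module.End.mul_apply,
      ← CoxeterMatrix.toCoxeterSystem_simple, geomRep_simple]
    rw [CoxeterMatrix.toCoxeterSystem_simple]
    by_cases hka : k = a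
    · subst hka
      rw [simpleReflection_apply_self, ih', if_neg hl.1, if_pos List.mem_cons_self,
        SimpleGraph.adjMatrix_mulVec_apply, SimpleGraph.adjMatrix_mulVec_apply]
      congr 1
      refine Finset.sum_congr rfl fun u hu => ?_
      rw [ih', if_neg]
      intro hul
      exact hadj k List.mem_cons_self u (List.mem_cons_of_mem _ hul) (by simpa using hu)
    · rw [simpleReflection_apply_of_ne Γ hka, ih']
      simp [hka]

end ADEDiagram

end

/-! ### Chebyshev polynomials of the adjacency matrix, roots, and powers of the Coxeter element -/

noncomputable section
namespace ADEDiagram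

open Matrix Polynomial

variable (Γ : ADEDiagram)

/-- The value `Δ_k(A)` of a Chebyshev polynomial at the adjacency matrix. -/
def chebMatrix (k : ℤ) : Matrix (Fin Γ.rank) (Fin Γ.rank) ℝ :=
  aeval (Γ.graph.adjMatrix ℝ) (Chebyshev.S ℤ k)

theorem chebMatrix_add_two (k : ℤ) :
    Γ.chebMatrix (k + 2) = Γ.graph.adjMatrix ℝ * Γ.chebMatrix (k + 1) - Γ.chebMatrix k := by
  simp [chebMatrix, Chebyshev.S_add_two]

theorem chebMatrix_sub_one (k : ℤ) :
    Γ.chebMatrix (k - 1) = Γ.graph.adjMatrix ℝ * Γ.chebMatrix k - Γ.chebMatrix (k + 1) := by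
  simp [chebMatrix, Chebyshev.S_sub_one]

@[simp] theorem chebMatrix_zero : Γ.chebMatrix 0 = 1 := by simp [chebMatrix]

@[simp] theorem chebMatrix_one : Γ.chebMatrix 1 = Γ.graph.adjMatrix ℝ := by simp [chebMatrix]

@[simp] theorem chebMatrix_neg_one : Γ.chebMatrix (-1) = 0 := by simp [chebMatrix]

@[simp] theorem chebMatrix_neg_two : Γ.chebMatrix (-2) = -1 := by simp [chebMatrix]

theorem chebMatrix_transpose (k : ℕ) : (Γ.chebMatrix k)ᵀ = Γ.chebMatrix k := by
  have comm : ∀ j, Γ.chebMatrix j * Γ.graph.adjMatrix ℝ = Γ.graph.adjMatrix ℝ * Γ.chebMatrix j :=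
    fun j => by
      calc _ = aeval (Γ.graph.adjMatrix ℝ) (Chebyshev.S ℤ j * X) := by simp [chebMatrix]
        _ = aeval (Γ.graph.adjMatrix ℝ) (X * Chebyshev.S ℤ j) := by rw [mul_comm]
        _ = _ := by simp [chebMatrix]
  induction k using Nat.twoStepInduction with
  | zero => simp
  | one => simp
  | more k h0 h1 =>
    push_cast at h0 h1 ⊢
    rw [chebMatrix_add_two, transpose_sub, transpose_mul, h0, h1, SimpleGraph.transpose_adjMatrix,
      comm]

theorem chebMatrix_mulVec_of_eigenvector {t : ℝ} {v : Γ.V}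
    (hv : Γ.graph.adjMatrix ℝ *ᵥ v = t • v) (k : ℕ) :
    Γ.chebMatrix k *ᵥ v = (Chebyshev.S ℝ k).eval t • v := by
  induction k using Nat.twoStepInduction with
  | zero => simp
  | one => simp [hv]
  | more k h0 h1 =>
    push_cast at h0 h1 ⊢
    rw [chebMatrix_add_two, sub_mulVec, ← mulVec_mulVec, h0, h1, mulVec_smul, hv,
      Chebyshev.S_add_two]
    simp only [eval_sub, eval_mul, eval_X]
    module

variable {Γ}

section Coloring

variable {c : Fin Γ.rank → Bool} (hc : ∀ i j, Γ.graph.Adj i j → c i ≠ c j)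

include hc

/-- `Δ_k` has the parity of `k`, and each application of the adjacency matrix switches the colour.
-/
theorem chebMatrix_apply_eq_zero (k : ℕ) (i j : Fin Γ.rank) (h : c i ≠ (c j ^^ k.bodd)) :
    Γ.chebMatrix k i j = 0 := by
  induction k using Nat.twoStepInduction generalizing i with
  | zero =>
    have : i ≠ j := by rintro rfl; simp at h
    simp [this]
  | one =>
    have : ¬Γ.graph.Adj i j := fun h' => by
      have := hc i j h'
      revert h this
      cases c i <;> cases c j <;> simp
    simp [this]
  | more k h0 h1 =>
    push_cast at h0 h1 ⊢
    rw [chebMatrix_add_two, Matrix.sub_apply, h0 i (by simpa using h),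
      SimpleGraph.adjMatrix_mul_apply, Finset.sum_eq_zero, sub_zero]
    intro u hu
    refine h1 u fun h' => ?_
    have := hc i u (by simpa using hu)
    revert h h' this
    simp only [Nat.bodd_succ]
    cases c i <;> cases c j <;> cases c u <;> cases k.bodd <;> simp

theorem adjMatrix_mulVec_support {b : Bool} {x : Γ.V} (hx : ∀ k, c k ≠ b → x k = 0)
    (k : Fin Γ.rank) (hk : c k ≠ !b) : (Γ.graph.adjMatrix ℝ *ᵥ x) k = 0 := by
  rw [SimpleGraph.adjMatrix_mulVec_apply]
  refine Finset.sum_eq_zero fun u hu => hx u ?_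
  have := hc k u (by simpa using hu)
  revert hk this
  cases c k <;> cases c u <;> cases b <;> simp

/-- This is one step of the Chebyshev recurrence: for consecutive terms `x`, `y` of a solution, `y`
is replaced by the term that follows `x`. -/
theorem colorReflection_add {b : Bool} {x y : Γ.V} (hx : ∀ k, c k ≠ b → x k = 0)
    (hy : ∀ k, c k ≠ (!b) → y k = 0) :
    Γ.colorReflection c (!b) (x + y) = x + (Γ.graph.adjMatrix ℝ *ᵥ x - y) := by
  ext k
  have h1 := adjMatrix_mulVec_support hc hx k
  have h2 := adjMatrix_mulVec_support hc hy k
  have h3 := hx k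
  have h4 := hy k
  rw [colorReflection_apply, mulVec_add]
  simp only [Pi.add_apply, Pi.sub_apply]
  rw [Bool.not_not] at h2
  by_cases hk : c k = !b
  · have hk' : c k ≠ b := by rw [hk]; simp
    rw [if_pos hk, h2 hk', h3 hk']
    ring
  · rw [if_neg hk, h1 hk, h4 hk]
    ring

end Coloring

variable (Γ)

/-- The colouring by the parity of the distance to the first vertex. -/
def distColor (k : Fin Γ.rank) : Bool := decide (Even (Γ.graph.dist k Γ.root))

variable {Γ}

/-- In a connected graph a 2-colouring determines the parity of every distance to the first vertex.
Explicit colourings of the diagrams can therefore be transferred to the one that defines the Coxeter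
element. -/
theorem distColor_ne_of_coloring (hconn : Γ.graph.Connected) {c : Fin Γ.rank → Bool}
    (hc : ∀ i j, Γ.graph.Adj i j → c i ≠ c j) (i j : Fin Γ.rank) (h : Γ.graph.Adj i j) :
    Γ.distColor i ≠ Γ.distColor j := by
  let C : Γ.graph.Coloring Bool := SimpleGraph.Coloring.mk c (fun {i j} h => hc i j h)
  have key : ∀ k, Even (Γ.graph.dist k Γ.root) ↔ (c k ↔ c Γ.root) := fun k => by
    obtain ⟨p, hp⟩ := hconn.exists_walk_length_eq_dist k Γ.root
    rw [← hp]
    exact C.even_length_iff_congr p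
  have h' := hc i j h
  simp only [distColor, ne_eq, decide_eq_decide, key]
  revert h'
  cases c i <;> cases c j <;> cases c Γ.root <;> simp

section DistColor

variable (hd : ∀ i j, Γ.graph.Adj i j → Γ.distColor i ≠ Γ.distColor j)

include hd

theorem geomRep_gammaPlus : Γ.geomRep Γ.gammaPlus = Γ.colorReflection Γ.distColor true := by
  refine LinearMap.ext fun v => funext fun k => ?_
  rw [gammaPlus, geomRep_prod_map_simple, colorReflection_apply]
  · simp [distColor]
  · exact (List.nodup_finRange _).filter _
  · intro i hi j hj hij
    refine hd i j hij ?_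
    simp only [List.mem_filter, decide_eq_true_eq] at hi hj
    simp [distColor, hi.2, hj.2]

theorem geomRep_gammaMinus : Γ.geomRep Γ.gammaMinus = Γ.colorReflection Γ.distColor false := by
  refine LinearMap.ext fun v => funext fun k => ?_
  rw [gammaMinus, geomRep_prod_map_simple, colorReflection_apply]
  · simp [distColor]
  · exact (List.nodup_finRange _).filter _
  · intro i hi j hj hij
    refine hd i j hij ?_
    simp only [List.mem_filter, decide_eq_true_eq, ← Nat.not_even_iff_odd] at hi hj
    simp [distColor, hi.2, hj.2]

theorem exists_geomRep_eq_colorReflection (b : Bool) :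
    ∃ w, Γ.geomRep w = Γ.colorReflection Γ.distColor b := by
  cases b
  · exact ⟨_, geomRep_gammaMinus hd⟩
  · exact ⟨_, geomRep_gammaPlus hd⟩

/-- The sums of consecutive `Δ_k(A) α_i` are roots. -/
theorem exists_geomRep_single_eq (i : Fin Γ.rank) (k : ℕ) :
    ∃ w, Γ.geomRep w (Pi.single i 1) =
      Γ.chebMatrix k *ᵥ Pi.single i 1 + Γ.chebMatrix (k - 1) *ᵥ Pi.single i 1 := by
  have supp : ∀ (k : ℕ) (j : Fin Γ.rank), Γ.distColor j ≠ (Γ.distColor i ^^ k.bodd) →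
      (Γ.chebMatrix k *ᵥ Pi.single i 1) j = 0 := fun k j h => by
    rw [mulVec_single_one]
    exact chebMatrix_apply_eq_zero hd k j i h
  have step : ∀ k : ℤ, Γ.chebMatrix (k + 1) *ᵥ Pi.single i 1 =
      Γ.graph.adjMatrix ℝ *ᵥ Γ.chebMatrix k *ᵥ Pi.single i 1 -
        Γ.chebMatrix (k - 1) *ᵥ Pi.single i 1 := fun k => by
    rw [chebMatrix_sub_one, sub_mulVec, mulVec_mulVec]
    abel
  induction k with
  | zero => exact ⟨1, by simp [-mulVec_single]⟩
  | succ k ih =>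
    obtain ⟨w, hw⟩ := ih
    -- This is the colour on which `Δ_{k-1}(A) α_i` lives; reflecting there turns it into
    -- `Δ_{k+1}(A) α_i` and keeps `Δ_k(A) α_i`.
    obtain ⟨u, hu⟩ := exists_geomRep_eq_colorReflection hd (!(Γ.distColor i ^^ k.bodd))
    refine ⟨u * w, ?_⟩
    rw [map_mul, Module.End.mul_apply, hw, hu, colorReflection_add hd (supp k), ← step]
    · push_cast
      rw [add_sub_cancel_right, add_comm]
    · cases k with
      | zero => simp
      | succ k =>
        intro j hj
        have := supp k j
        push_cast
        rw [add_sub_cancel_right]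
        refine this fun h => hj ?_
        rw [h]
        simp

/-- The terms of `Y` alternate in colour. Thus `γ⁻` advances the pair `(Y (2k+1), Y (2k))` by one
index and `γ⁺` by one more, so `γ` shifts by two. -/
theorem geomRep_coxeterElement_pow (Y : ℕ → Γ.V)
    (hY : ∀ k, Y (k + 2) = Γ.graph.adjMatrix ℝ *ᵥ Y (k + 1) - Y k)
    (h0 : ∀ k, Γ.distColor k ≠ false → Y 0 k = 0) (h1 : ∀ k, Γ.distColor k ≠ true → Y 1 k = 0)
    (k : ℕ) : Γ.geomRep (Γ.coxeterElement ^ k) (Y 1 + Y 0) = Y (2 * k + 1) + Y (2 * k) := by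
  have supp : ∀ k j, Γ.distColor j ≠ k.bodd → Y k j = 0 := by
    intro k
    induction k using Nat.twoStepInduction with
    | zero => simpa using h0
    | one => simpa using h1
    | more k ih0 ih1 =>
      intro j hj
      rw [hY, Pi.sub_apply, ih0 j (by simpa using hj),
        adjMatrix_mulVec_support hd ih1 j (by simpa using hj), sub_zero]
  induction k with
  | zero => simp
  | succ k ih =>
    rw [pow_succ', map_mul, Module.End.mul_apply, ih, coxeterElement, map_mul,
      Module.End.mul_apply, geomRep_gammaPlus hd, geomRep_gammaMinus hd]
    have e1 : Γ.colorReflection Γ.distColor false (Y (2 * k + 1) + Y (2 * k)) =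
        Y (2 * k + 2) + Y (2 * k + 1) := by
      rw [hY, ← Bool.not_true, colorReflection_add hd, add_comm]
      · simpa using supp (2 * k + 1)
      · simpa using supp (2 * k)
    have e2 : Γ.colorReflection Γ.distColor true (Y (2 * k + 2) + Y (2 * k + 1)) =
        Y (2 * k + 3) + Y (2 * k + 2) := by
      rw [hY (2 * k + 1), ← Bool.not_false, colorReflection_add hd, add_comm]
      · simpa using supp (2 * k + 2)
      · simpa using supp (2 * k + 1)
    rw [e1, e2]
    rfl

end DistColor

end ADEDiagram

end

/-! ### Consequences of a Perron vector: non-negativity, vanishing of `Δ_{h-1}(A)`, and the order of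
the Coxeter element -/

noncomputable section
namespace ADEDiagram

open Matrix Polynomial

/-- `Γ` is a connected bipartite graph, and its adjacency matrix has a positive eigenvector `v` for
the eigenvalue `2 cos (π / h)`. -/
structure HasPerronVector (Γ : ADEDiagram) (h : ℕ) (v : Γ.V) : Prop where
  two_le : 2 ≤ h
  connected : Γ.graph.Connected
  distColor_ne : ∀ i j, Γ.graph.Adj i j → Γ.distColor i ≠ Γ.distColor j
  pos : ∀ i, 0 < v i
  mulVec_eq : Γ.graph.adjMatrix ℝ *ᵥ v = (2 * Real.cos (Real.pi / h)) • v

theorem sin_pi_div_pos {h : ℕ} (hh : 2 ≤ h) : 0 < Real.sin (Real.pi / h) := by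
  have : (2 : ℝ) ≤ h := by exact_mod_cast hh
  refine Real.sin_pos_of_pos_of_lt_pi (by positivity) ?_
  rw [div_lt_iff₀ (by positivity)]
  nlinarith [Real.pi_pos]

/-- `Δ_k(2 cos θ) sin θ = sin ((k + 1) θ)`, and for `θ = π / h` both angles lie strictly between `0`
and `π`. -/
theorem eval_S_pos {h : ℕ} (hh : 2 ≤ h) {k : ℕ} (hk : k + 1 < h) :
    0 < (Chebyshev.S ℝ k).eval (2 * Real.cos (Real.pi / h)) := by
  have h1 := Chebyshev.S_two_mul_real_cos (Real.pi / h) k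
  have h2 : 0 < Real.sin (((k : ℤ) + 1) * (Real.pi / h)) := by
    have : (0 : ℝ) < h := by exact_mod_cast (by omega : 0 < h)
    have hk' : (k : ℝ) + 1 < h := by exact_mod_cast hk
    push_cast
    refine Real.sin_pos_of_pos_of_lt_pi (by positivity) ?_
    rw [← mul_div_assoc, div_lt_iff₀ this]
    nlinarith [Real.pi_pos]
  rw [← h1] at h2
  exact (pos_iff_pos_of_mul_pos h2).2 (sin_pi_div_pos hh)

theorem eval_S_pred_eq_zero {h : ℕ} (hh : 2 ≤ h) :
    (Chebyshev.S ℝ (h - 1)).eval (2 * Real.cos (Real.pi / h)) = 0 := by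
  have h1 := Chebyshev.S_two_mul_real_cos (Real.pi / h) (h - 1)
  have h3 : (h : ℝ) ≠ 0 := by exact_mod_cast (by omega : h ≠ 0)
  have h2 : (((h - 1 : ℤ) : ℝ) + 1) * (Real.pi / h) = Real.pi := by
    push_cast
    field_simp
    ring
  rw [h2, Real.sin_pi] at h1
  exact (mul_eq_zero.1 h1).resolve_right (sin_pi_div_pos hh).ne'

namespace HasPerronVector

variable {Γ : ADEDiagram} {h : ℕ} {v : Γ.V} (H : Γ.HasPerronVector h v)

include H

theorem dotProduct_chebMatrix_mulVec (k : ℕ) (i : Fin Γ.rank) :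
    v ⬝ᵥ (Γ.chebMatrix k *ᵥ Pi.single i 1) =
      (Chebyshev.S ℝ k).eval (2 * Real.cos (Real.pi / h)) * v i := by
  rw [dotProduct_mulVec, ← mulVec_transpose, chebMatrix_transpose,
    Γ.chebMatrix_mulVec_of_eigenvector H.mulVec_eq]
  simp

/-- The vector is a root, so its coordinates have one sign. Its pairing with `v` is `(Δ_k(t) +
Δ_{k-1}(t)) v_i > 0`; even at `k = h - 1`, where `Δ_k(t) = 0`, the second term is positive. -/
theorem root_nonneg (k : ℕ) (hk : k < h) (i : Fin Γ.rank) :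
    0 ≤ Γ.chebMatrix k *ᵥ Pi.single i 1 + Γ.chebMatrix (k - 1) *ᵥ Pi.single i 1 := by
  obtain ⟨w, hw⟩ := exists_geomRep_single_eq H.distColor_ne i k
  rw [← hw]
  refine (Γ.geomRep_single_nonneg_or_nonpos w i).resolve_right fun hneg => ?_
  have h1 : v ⬝ᵥ Γ.geomRep w (Pi.single i 1) ≤ 0 := by
    refine Finset.sum_nonpos fun j _ => mul_nonpos_of_nonneg_of_nonpos (H.pos j).le (hneg j)
  rw [hw, dotProduct_add, H.dotProduct_chebMatrix_mulVec] at h1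
  refine not_lt.2 h1 ?_
  cases k with
  | zero => simpa [-mulVec_single] using H.pos i
  | succ k =>
    have h2 := mul_pos (eval_S_pos H.two_le hk) (H.pos i)
    have h3 : 0 ≤ (Chebyshev.S ℝ ((k + 1 : ℕ) : ℤ)).eval (2 * Real.cos (Real.pi / h)) := by
      rcases lt_or_eq_of_le (show k + 1 + 1 ≤ h from hk) with h' | h'
      · exact (eval_S_pos H.two_le h').le
      · have := eval_S_pred_eq_zero H.two_le
        rw [← h'] at this ⊢
        push_cast at this ⊢
        rw [add_sub_cancel_right] at this
        exact this.ge
    push_cast at h3 ⊢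
    rw [add_sub_cancel_right, H.dotProduct_chebMatrix_mulVec]
    exact add_pos_of_nonneg_of_pos (mul_nonneg h3 (H.pos i).le) h2

/-- The two summands of the positive root in `root_nonneg` are supported on opposite colours, so
neither can cancel negative entries of the other. -/
theorem chebMatrix_nonneg (k : ℕ) (hk : k < h) (i j : Fin Γ.rank) : 0 ≤ Γ.chebMatrix k i j := by
  by_cases hc : Γ.distColor i = (Γ.distColor j ^^ k.bodd)
  · have h1 := H.root_nonneg k hk j i
    cases k with
    | zero => simpa using h1
    | succ k =>
      have h2 : Γ.chebMatrix k i j = 0 := by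
        refine chebMatrix_apply_eq_zero H.distColor_ne k i j ?_
        rw [hc]
        simp
      push_cast at h1 ⊢
      rw [add_sub_cancel_right, mulVec_single_one, mulVec_single_one] at h1
      simpa [h2] using h1
  · exact (chebMatrix_apply_eq_zero H.distColor_ne k i j hc).ge

/-- Each column is non-negative and pairs to `Δ_{h-1}(t) v_j = 0` with the strictly positive `v`. -/
theorem chebMatrix_pred_eq_zero : Γ.chebMatrix (h - 1) = 0 := by
  obtain ⟨n, rfl⟩ : ∃ n, h = n + 1 := ⟨h - 1, by have := H.two_le; omega⟩
  push_cast
  rw [add_sub_cancel_right]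
  ext i j
  have h1 := H.dotProduct_chebMatrix_mulVec n j
  have h2 := eval_S_pred_eq_zero H.two_le
  push_cast at h1 h2
  rw [add_sub_cancel_right] at h2
  rw [h2, zero_mul, mulVec_single_one] at h1
  have h3 := (Finset.sum_eq_zero_iff_of_nonneg fun i _ =>
    mul_nonneg (H.pos i).le (H.chebMatrix_nonneg n (by omega) i j)).1 h1 i (Finset.mem_univ i)
  exact (mul_eq_zero.1 h3).resolve_left (H.pos i).ne'

/-- The recurrence is the same in both directions, so a solution that vanishes at `h - 1` is
antisymmetric about `h - 1`. Together with the antisymmetry about `-1`, this gives period `2h`. -/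
theorem chebMatrix_reflect (k : ℕ) :
    Γ.chebMatrix (h - 1 + k) = -Γ.chebMatrix (h - 1 - k) := by
  induction k using Nat.twoStepInduction with
  | zero => simp [H.chebMatrix_pred_eq_zero]
  | one =>
    have := Γ.chebMatrix_sub_one (h - 1)
    rw [H.chebMatrix_pred_eq_zero, mul_zero, zero_sub] at this
    simp [this]
  | more k h0 h1 =>
    have e1 := Γ.chebMatrix_add_two (h - 1 + k)
    have e2 := Γ.chebMatrix_sub_one (h - 1 - (k + 1))
    push_cast at h0 h1 ⊢
    rw [show (h : ℤ) - 1 + (k + 2) = h - 1 + k + 2 by ring, e1, h0,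
      show (h : ℤ) - 1 + k + 1 = h - 1 + (k + 1) by ring, h1,
      show (h : ℤ) - 1 - (k + 2) = h - 1 - (k + 1) - 1 by ring, e2,
      show (h : ℤ) - 1 - (k + 1) + 1 = h - 1 - k by ring]
    simp only [mul_neg]
    abel

theorem coxeterElement_pow_eq_one : Γ.coxeterElement ^ h = 1 := by
  refine Γ.geomRep_injective (LinearMap.ext fun u => ?_)
  let x : Bool → Γ.V := fun b k => if Γ.distColor k = b then u k else 0
  -- The solution of the recurrence whose terms `Y 1` and `Y 0` are the two colour parts of `u`.
  let Y : ℕ → Γ.V := fun k => Γ.chebMatrix (k - 1) *ᵥ x true - Γ.chebMatrix (k - 2) *ᵥ x false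
  have hu : u = Y 1 + Y 0 := by
    ext k
    cases hk : Γ.distColor k <;> simp [Y, x, hk, neg_mulVec]
  have e0 := H.chebMatrix_reflect h
  have e1 := H.chebMatrix_reflect (h - 1)
  have e2 := H.chebMatrix_reflect (h + 1)
  push_cast [Nat.cast_sub (show 1 ≤ h by have := H.two_le; omega)] at e0 e1 e2
  rw [sub_self, chebMatrix_zero] at e1
  rw [show (h : ℤ) - 1 - h = -1 by ring, chebMatrix_neg_one, neg_zero] at e0
  rw [show (h : ℤ) - 1 - (h + 1) = -2 by ring, chebMatrix_neg_two, neg_neg] at e2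
  conv_lhs => rw [hu]
  rw [geomRep_coxeterElement_pow H.distColor_ne Y, map_one, Module.End.one_apply]
  · have : Y (2 * h + 1) = Y 1 := by
      simp only [Y]
      push_cast
      rw [show 2 * (h : ℤ) + 1 - 1 = h - 1 + (h + 1) by ring, e2,
        show 2 * (h : ℤ) + 1 - 2 = h - 1 + h by ring, e0]
      simp
    have h' : Y (2 * h) = Y 0 := by
      simp only [Y]
      push_cast
      rw [show 2 * (h : ℤ) - 1 = h - 1 + h by ring, e0,
        show 2 * (h : ℤ) - 2 = h - 1 + (h - 1) by ring, e1]
      simp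
    rw [this, h', ← hu]
  · intro k
    simp only [Y]
    push_cast
    have s1 := Γ.chebMatrix_add_two ((k : ℤ) - 1)
    have s2 := Γ.chebMatrix_add_two ((k : ℤ) - 2)
    rw [show (k : ℤ) + 2 - 1 = k - 1 + 2 by ring, s1,
      show (k : ℤ) + 2 - 2 = k - 2 + 2 by ring, s2,
      show (k : ℤ) + 1 - 1 = k - 1 + 1 by ring,
      show (k : ℤ) + 1 - 2 = k - 2 + 1 by ring]
    simp only [sub_mulVec, mulVec_sub, mulVec_mulVec]
    abel
  · intro k hk
    have hk' : Γ.distColor k = true := by simpa using hk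
    simp [Y, x, neg_mulVec, hk']
  · intro k hk
    have hk' : Γ.distColor k = false := by simpa using hk
    simp [Y, x, hk']

/-- On the span of the two colour parts of `v`, the recurrence becomes scalar with solutions built
from `sin ((j + 1) π / h)`; returning to the start after `2k` steps forces `2k π / h` to be a
multiple of `2π`. -/
theorem dvd_of_coxeterElement_pow_eq_one {k : ℕ} (hk : Γ.coxeterElement ^ k = 1) : h ∣ k := by
  set t := 2 * Real.cos (Real.pi / h) with ht
  let x : Bool → Γ.V := fun b k => if Γ.distColor k = b then v k else 0
  have hx : ∀ b, Γ.graph.adjMatrix ℝ *ᵥ x b = t • x (!b) := fun b => by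
    ext j
    have hj := congrFun H.mulVec_eq j
    rw [SimpleGraph.adjMatrix_mulVec_apply] at hj ⊢
    have hb : ∀ u ∈ Γ.graph.neighborFinset j,
        x b u = if Γ.distColor j = !b then v u else 0 := fun u hu => by
      have := H.distColor_ne j u (by simpa using hu)
      simp only [x]
      revert this
      cases Γ.distColor j <;> cases Γ.distColor u <;> cases b <;> simp
    rw [Finset.sum_congr rfl hb]
    by_cases hjb : Γ.distColor j = !b
    · simpa [x, hjb] using hj
    · simp [x, hjb]
  let s : ℤ → ℝ := fun j => (Chebyshev.S ℝ j).eval t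
  have hs : ∀ j, s (j + 2) = t * s (j + 1) - s j := fun j => by
    simp [s, Chebyshev.S_add_two]
  have hroot : x true Γ.root = v Γ.root ∧ x false Γ.root = 0 := by simp [x, distColor]
  -- The parameter `a` varies the initial value `Y 0`. Only the odd term `Y (2k + 1)` is seen at the
  -- first vertex; the cases `a = 0` and `a = 1` separate `s (2k)` from `s (2k - 1)`.
  have key : ∀ a : ℝ, s (2 * k) - a * s (2 * k - 1) = 1 := fun a => by
    let Y : ℕ → Γ.V := fun j => (s (j - 1) - a * s (j - 2)) • x j.bodd
    have hYk := geomRep_coxeterElement_pow H.distColor_ne Y (fun j => by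
        have s1 := hs ((j : ℤ) - 1)
        have s2 := hs ((j : ℤ) - 2)
        simp only [Y]
        push_cast
        rw [show (j : ℤ) + 2 - 1 = j - 1 + 2 by ring, s1,
          show (j : ℤ) + 2 - 2 = j - 2 + 2 by ring, s2,
          show (j : ℤ) + 1 - 1 = j - 1 + 1 by ring,
          show (j : ℤ) + 1 - 2 = j - 2 + 1 by ring, mulVec_smul, hx]
        simp only [Nat.bodd_succ, Bool.not_not]
        module)
      (fun j hj => by
        have hj' : Γ.distColor j = true := by simpa using hj
        simp [Y, x, hj']) (fun j hj => by
        have hj' : Γ.distColor j = false := by simpa using hj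
        simp [Y, x, hj']) k
    rw [hk, map_one, Module.End.one_apply] at hYk
    have := congrFun hYk Γ.root
    simp [Y, hroot, s, (H.pos Γ.root).ne'] at this
    rwa [show (2 * k + 1 - 2 : ℤ) = 2 * k - 1 by ring] at this
  have k0 : s (2 * k) = 1 := by simpa using key 0
  have k1 : s (2 * k - 1) = 0 := by linarith [key 1]
  have hsin := sin_pi_div_pos H.two_le
  have t0 := Chebyshev.S_two_mul_real_cos (Real.pi / h) (2 * k)
  have t1 := Chebyshev.S_two_mul_real_cos (Real.pi / h) (2 * k - 1)
  change s _ * _ = _ at t0 t1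
  rw [k0, one_mul] at t0
  rw [k1, zero_mul] at t1
  push_cast at t0 t1
  rw [sub_add_cancel] at t1
  rw [add_mul, one_mul, Real.sin_add, ← t1, zero_mul, zero_add] at t0
  have hcos : Real.cos (2 * k * (Real.pi / h)) = 1 := mul_right_cancel₀ hsin.ne' (by linarith)
  obtain ⟨m, hm⟩ := (Real.cos_eq_one_iff _).1 hcos
  have hh : (h : ℝ) ≠ 0 := by have := H.two_le; exact_mod_cast (by omega : h ≠ 0)
  have : (m : ℝ) * h = k := by
    field_simp at hm
    nlinarith [Real.pi_pos]
  have : m * (h : ℤ) = k := by exact_mod_cast this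
  exact Int.natCast_dvd_natCast.1 ⟨m, by rw [← this, mul_comm]⟩

theorem coxeterNumber_eq : Γ.coxeterNumber = h :=
  Nat.dvd_antisymm (orderOf_dvd_of_pow_eq_one H.coxeterElement_pow_eq_one)
    (H.dvd_of_coxeterElement_pow_eq_one (pow_orderOf_eq_one _))

end HasPerronVector

end ADEDiagram

end

/-! ### The eigenspaces for `± 2 cos (π / h)` and the Coxeter plane -/

noncomputable section
namespace ADEDiagram

open Matrix Polynomial

theorem two_smul_one_sub_cartanMatrix (Γ : ADEDiagram) :
    (2 : ℝ) • (1 : Matrix (Fin Γ.rank) (Fin Γ.rank) ℝ) - Γ.cartanMatrix =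
      Γ.graph.adjMatrix ℝ := by
  ext i j
  rw [Matrix.sub_apply, Matrix.smul_apply, cartanMatrix, Matrix.of_apply]
  by_cases hij : i = j
  · subst hij
    simp
  · by_cases h : Γ.graph.Adj i j
    · simp [coxeterMatrix_of_adj Γ h, hij, h]
    · simp [coxeterMatrix_of_not_adj Γ hij h, hij, h]

theorem mem_eigenspace {Γ : ADEDiagram} {t : ℝ} {w : Γ.V} :
    w ∈ Γ.eigenspace t ↔ Γ.graph.adjMatrix ℝ *ᵥ w = t • w := by
  rw [eigenspace, two_smul_one_sub_cartanMatrix, Module.End.mem_eigenspace_iff, toLin'_apply]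

namespace HasPerronVector

variable {Γ : ADEDiagram} {h : ℕ} {v : Γ.V} (H : Γ.HasPerronVector h v)

include H

/-- At a zero of `u`, the sum of the non-negative neighbouring values is zero, so the zero spreads
to all neighbours and, by connectedness, everywhere. -/
theorem eigenvector_eq_zero {t : ℝ} {u : Γ.V} (hu : Γ.graph.adjMatrix ℝ *ᵥ u = t • u)
    (h0 : 0 ≤ u) {i : Fin Γ.rank} (hi : u i = 0) : u = 0 := by
  have step : ∀ j k, Γ.graph.Adj j k → u j = 0 → u k = 0 := fun j k hjk hj => by
    have := congrFun hu j
    rw [SimpleGraph.adjMatrix_mulVec_apply, Pi.smul_apply, hj, smul_zero,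
      Finset.sum_eq_zero_iff_of_nonneg fun k _ => h0 k] at this
    exact this k (by simpa using hjk)
  ext j
  obtain ⟨p⟩ := H.connected.preconnected i j
  induction p with
  | nil => exact hi
  | cons hadj _ ih => exact ih (step _ _ hadj hi)

/-- The Perron-Frobenius eigenvector is unique up to scaling. -/
theorem exists_eq_smul {w : Γ.V}
    (hw : Γ.graph.adjMatrix ℝ *ᵥ w = (2 * Real.cos (Real.pi / h)) • w) : ∃ r : ℝ, w = r • v := by
  have : Nonempty (Fin Γ.rank) := ⟨Γ.root⟩
  -- For the minimal ratio `w i / v i`, the eigenvector `w - (w i / v i) v` is non-negative and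
  -- vanishes at `i`.
  obtain ⟨i, hi⟩ := Finite.exists_min fun i => w i / v i
  refine ⟨w i / v i, sub_eq_zero.1 ?_⟩
  refine H.eigenvector_eq_zero (t := 2 * Real.cos (Real.pi / h)) (i := i) ?_ ?_ ?_
  · rw [mulVec_sub, mulVec_smul, hw, H.mulVec_eq]
    module
  · intro j
    have := (le_div_iff₀ (H.pos j)).1 (hi j)
    simpa using this
  · simp [ne_of_gt (H.pos i)]

/-- Changing the signs of the coordinates at odd distance from the root anticommutes with the
adjacency matrix. -/
theorem adjMatrix_mulVec_sign (w : Γ.V) :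
    (Γ.graph.adjMatrix ℝ *ᵥ fun k => if Γ.distColor k then w k else -w k) =
      fun k => -(if Γ.distColor k then (Γ.graph.adjMatrix ℝ *ᵥ w) k
        else -(Γ.graph.adjMatrix ℝ *ᵥ w) k) := by
  ext k
  simp only [SimpleGraph.adjMatrix_mulVec_apply]
  have hne : ∀ u ∈ Γ.graph.neighborFinset k,
      (if Γ.distColor u then w u else -w u) = if Γ.distColor k then -w u else w u := fun u hu => by
    have := H.distColor_ne k u (by simpa using hu)
    revert this
    cases Γ.distColor k <;> cases Γ.distColor u <;> simp
  rw [Finset.sum_congr rfl hne]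
  cases Γ.distColor k <;> simp

theorem finrank_eigenspace :
    Module.finrank ℝ (Γ.eigenspace (2 * Real.cos (Real.pi / h))) = 1 := by
  refine finrank_eq_one_iff'.2 ⟨⟨v, mem_eigenspace.2 H.mulVec_eq⟩, ?_, ?_⟩
  · intro h0
    have := congrFun (congrArg Subtype.val h0) Γ.root
    exact (H.pos _).ne' this
  · rintro ⟨w, hw⟩
    obtain ⟨r, rfl⟩ := H.exists_eq_smul (mem_eigenspace.1 hw)
    exact ⟨r, rfl⟩

theorem finrank_eigenspace_neg :
    Module.finrank ℝ (Γ.eigenspace (-(2 * Real.cos (Real.pi / h)))) = 1 := by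
  refine finrank_eq_one_iff'.2 ⟨⟨fun k => if Γ.distColor k then v k else -v k, ?_⟩, ?_, ?_⟩
  · rw [mem_eigenspace, H.adjMatrix_mulVec_sign, H.mulVec_eq]
    ext k
    simp only [Pi.smul_apply, smul_eq_mul]
    split_ifs <;> ring
  · intro h0
    have := congrFun (congrArg Subtype.val h0) Γ.root
    simp [distColor] at this
    exact (H.pos _).ne' this
  · rintro ⟨w, hw⟩
    rw [mem_eigenspace] at hw
    obtain ⟨r, hr⟩ := H.exists_eq_smul (w := fun k => if Γ.distColor k then w k else -w k) (by
      rw [H.adjMatrix_mulVec_sign, hw]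
      ext k
      simp only [Pi.smul_apply, smul_eq_mul]
      split_ifs <;> ring)
    refine ⟨r, Subtype.ext (funext fun k => ?_)⟩
    have := congrFun hr k
    simp only [Pi.smul_apply, smul_eq_mul, SetLike.mk_smul_mk] at this ⊢
    split_ifs at this ⊢ <;> linarith

theorem finrank_coxeterPlane (hn : 2 ≤ Γ.rank) : Module.finrank ℝ Γ.coxeterPlane = 2 := by
  -- If the eigenvalue were zero, the positive entries of `v` at the neighbours of the first vertex
  -- would sum to zero. Without this the two eigenspaces would coincide, as they do for `A_1`.
  have hne : 2 * Real.cos (Real.pi / h) ≠ 0 := fun h0 => by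
    have : Nontrivial (Fin Γ.rank) := Fin.nontrivial_iff_two_le.2 hn
    obtain ⟨u, hu⟩ := H.connected.preconnected.exists_adj_of_nontrivial Γ.root
    have h1 := congrFun H.mulVec_eq Γ.root
    rw [h0, zero_smul, SimpleGraph.adjMatrix_mulVec_apply] at h1
    have := (Finset.sum_eq_zero_iff_of_nonneg fun k _ => (H.pos k).le).1 h1 u (by simpa using hu)
    exact (H.pos u).ne' this
  have hinf : Γ.eigenspace (2 * Real.cos (Real.pi / h)) ⊓
      Γ.eigenspace (-(2 * Real.cos (Real.pi / h))) = ⊥ := by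
    refine (Submodule.eq_bot_iff _).2 fun w hw => ?_
    obtain ⟨h1, h2⟩ := Submodule.mem_inf.1 hw
    rw [mem_eigenspace] at h1 h2
    rw [h1, neg_smul, ← sub_eq_zero, sub_neg_eq_add, ← two_smul ℝ, smul_smul, smul_eq_zero] at h2
    exact h2.resolve_left (mul_ne_zero two_ne_zero hne)
  have := Submodule.finrank_sup_add_finrank_inf_eq (Γ.eigenspace (2 * Real.cos (Real.pi / h)))
    (Γ.eigenspace (-(2 * Real.cos (Real.pi / h))))
  rw [hinf, finrank_bot, H.finrank_eigenspace, H.finrank_eigenspace_neg] at this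
  rw [coxeterPlane, H.coxeterNumber_eq]
  exact this

/-- The Coxeter plane is an eigenspace of the square of the adjacency matrix. -/
theorem mem_coxeterPlane_iff {w : Γ.V} :
    w ∈ Γ.coxeterPlane ↔ Γ.graph.adjMatrix ℝ *ᵥ Γ.graph.adjMatrix ℝ *ᵥ w =
      (2 * Real.cos (Real.pi / h)) ^ 2 • w := by
  rw [coxeterPlane, H.coxeterNumber_eq]
  set t := 2 * Real.cos (Real.pi / h)
  constructor
  · intro hw
    obtain ⟨x, hx, y, hy, rfl⟩ := Submodule.mem_sup.1 hw
    rw [mem_eigenspace] at hx hy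
    rw [mulVec_add, hx, hy, mulVec_add, mulVec_smul, mulVec_smul, hx, hy]
    module
  · intro hw
    -- For `t = 0`, symmetry gives `|A w|² = ⟨w, A² w⟩ = 0`. Otherwise `w` is the sum of `(w ± t⁻¹ A
    -- w) / 2`, which are eigenvectors for `± t`.
    by_cases ht : t = 0
    · refine Submodule.mem_sup_left (mem_eigenspace.2 ?_)
      rw [ht] at hw ⊢
      rw [zero_smul, ← dotProduct_self_eq_zero, dotProduct_mulVec, ← mulVec_transpose,
        SimpleGraph.transpose_adjMatrix, hw]
      simp
    · refine Submodule.mem_sup.2 ⟨(1 / 2 : ℝ) • (w + t⁻¹ • Γ.graph.adjMatrix ℝ *ᵥ w),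
        mem_eigenspace.2 ?_, (1 / 2 : ℝ) • (w - t⁻¹ • Γ.graph.adjMatrix ℝ *ᵥ w),
        mem_eigenspace.2 ?_, by module⟩
      · simp only [mulVec_smul, mulVec_add, hw, smul_add, smul_smul]
        rw [add_comm]
        congr 2 <;> field_simp
      · simp only [mulVec_smul, mulVec_sub, hw, smul_sub, smul_smul]
        rw [← neg_sub_neg]
        congr 1 <;> rw [← neg_smul] <;> congr 1 <;> field_simp

/-- The even Chebyshev polynomials satisfy `Δ_{2k+4} = (x² - 2) Δ_{2k+2} - Δ_{2k}`, which involves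
only `x²`, and `A²` is the scalar `t²` on the plane. -/
theorem chebMatrix_even_mulVec {w : Γ.V} (hw : w ∈ Γ.coxeterPlane) (k : ℕ) :
    Γ.chebMatrix (2 * k) *ᵥ w =
      (Chebyshev.S ℝ (2 * k)).eval (2 * Real.cos (Real.pi / h)) • w := by
  rw [H.mem_coxeterPlane_iff] at hw
  have recur : ∀ k : ℤ, Chebyshev.S ℤ (2 * (k + 2)) =
      X * (X * Chebyshev.S ℤ (2 * (k + 1))) - 2 * Chebyshev.S ℤ (2 * (k + 1)) -
        Chebyshev.S ℤ (2 * k) := fun k => by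
    have h1 := Chebyshev.S_add_two ℤ (2 * k)
    have h2 := Chebyshev.S_add_two ℤ (2 * k + 1)
    have h3 := Chebyshev.S_add_two ℤ (2 * k + 2)
    rw [show 2 * (k + 2) = 2 * k + 2 + 2 by ring, show 2 * (k + 1) = 2 * k + 2 by ring, h3,
      show 2 * k + 2 + 1 = 2 * k + 1 + 2 by ring, h2, show 2 * k + 1 + 1 = 2 * k + 2 by ring]
    linear_combination h1
  induction k using Nat.twoStepInduction with
  | zero => simp
  | one =>
    simp only [chebMatrix, Nat.cast_one, mul_one, Chebyshev.S_two]
    simp [sub_mulVec, pow_two, ← mulVec_mulVec, hw, sub_smul]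
  | more k h0 h1 =>
    have e1 : Γ.chebMatrix (2 * (k + 2)) = Γ.graph.adjMatrix ℝ *
        (Γ.graph.adjMatrix ℝ * Γ.chebMatrix (2 * (k + 1))) - (2 : ℝ) • Γ.chebMatrix (2 * (k + 1)) -
        Γ.chebMatrix (2 * k) := by
      have := congrArg (aeval (Γ.graph.adjMatrix ℝ)) (recur k)
      simpa [chebMatrix, two_mul, two_smul, add_mul] using this
    have e2 := congrArg (fun p => (p.map (Int.castRingHom ℝ)).eval (2 * Real.cos (Real.pi / h)))
      (recur k)
    simp only [Polynomial.map_sub, Polynomial.map_mul, Polynomial.map_X, Chebyshev.map_S,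
      eval_sub, eval_mul, eval_X, Polynomial.map_ofNat, eval_ofNat] at e2
    push_cast at h1 ⊢
    rw [e1, e2, sub_mulVec, sub_mulVec, ← mulVec_mulVec, ← mulVec_mulVec, smul_mulVec, h0, h1,
      mulVec_smul, mulVec_smul, hw]
    module

end HasPerronVector

end ADEDiagram

end

/-! ### Perron vectors of the diagrams, case by case -/

noncomputable section
namespace ADEDiagram

open Matrix Polynomial

variable {Γ : ADEDiagram}

theorem adj_iff {i j : Fin Γ.rank} : Γ.graph.Adj i j ↔ i ≠ j ∧ (Γ.Edge i j ∨ Γ.Edge j i) :=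
  SimpleGraph.fromRel_adj _ i j

/-- A criterion for `HasPerronVector`, in which each vertex except the first is attached to an
earlier one. -/
theorem HasPerronVector.of_parent {h : ℕ} (hh : 2 ≤ h) {f : ℕ → ℝ}
    (hpos : ∀ i < Γ.rank, 0 < f i)
    (hf : ∀ i < Γ.rank,
      ∑ j ∈ Finset.range Γ.rank, (if i ≠ j ∧ (Γ.Edge i j ∨ Γ.Edge j i) then f j else 0) =
        2 * Real.cos (Real.pi / h) * f i)
    (c : ℕ → Bool) (hc : ∀ i j : Fin Γ.rank, Γ.Edge i j → c i ≠ c j)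
    (hparent : ∀ j : Fin Γ.rank, 0 < (j : ℕ) → ∃ i : Fin Γ.rank, i < j ∧ Γ.Edge i j) :
    Γ.HasPerronVector h fun j => f j := by
  have hconn : Γ.graph.Connected := by
    have hr : ∀ (n : ℕ) (hn : n < Γ.rank), Γ.graph.Reachable ⟨n, hn⟩ Γ.root := by
      intro n
      induction n using Nat.strong_induction_on with
      | _ n ih =>
      intro hn
      rcases Nat.eq_zero_or_pos n with rfl | hn0
      · exact .rfl
      · obtain ⟨i, hi, hij⟩ := hparent ⟨n, hn⟩ hn0
        exact .trans (SimpleGraph.Adj.reachable (adj_iff.2 ⟨hi.ne', .inr hij⟩)) (ih i hi i.2)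
    have : Nonempty (Fin Γ.rank) := ⟨Γ.root⟩
    exact .mk fun i j => (hr i i.2).trans (hr j j.2).symm
  refine ⟨hh, hconn, distColor_ne_of_coloring hconn (c := fun i => c i) ?_, fun i => hpos i i.2, ?_⟩
  · intro i j hij
    rcases (adj_iff.1 hij).2 with h | h
    · exact hc i j h
    · exact (hc j i h).symm
  · ext i
    rw [Pi.smul_apply, smul_eq_mul, ← hf i i.2, Finset.sum_range]
    simp [mulVec, dotProduct, SimpleGraph.adjMatrix_apply, adj_iff, ite_and, Fin.val_inj]

/-- Since `f n = 0`, a fictitious vertex `n` may be added after the last one, which then obeys the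
same neighbour formula as the interior of the arm. -/
theorem sum_ite_range_eq {n : ℕ} {f : ℕ → ℝ} (hf : f n = 0) {P : ℕ → Prop} [DecidablePred P]
    {s : Finset ℕ} (hs : ∀ j, j ≤ n → (P j ↔ j ∈ s)) (hn : ∀ j ∈ s, j ≤ n) :
    ∑ j ∈ Finset.range n, (if P j then f j else 0) = ∑ j ∈ s, f j := by
  have : ∑ j ∈ Finset.range n, (if P j then f j else 0) =
      ∑ j ∈ Finset.range (n + 1), (if P j then f j else 0) := by
    simp [Finset.sum_range_succ, hf]
  rw [this, ← Finset.sum_filter]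
  congr 1
  ext j
  simp only [Finset.mem_filter, Finset.mem_range]
  constructor
  · rintro ⟨h1, h2⟩
    exact (hs j (by omega)).1 h2
  · intro h
    have := hn j h
    exact ⟨by omega, (hs j this).2 h⟩

/-- Sines in arithmetic progression satisfy the eigenvector equation by the addition formula, and
they vanish just beyond both ends of the path. -/
theorem hasPerronVector_A (n : ℕ) (hn : 1 ≤ n) : (A n hn).HasPerronVector (n + 1)
    (fun j => Real.sin (((j : ℕ) + 1 : ℝ) * (Real.pi / (n + 1 : ℕ)))) := by
  have hn0 : (0 : ℝ) < (n + 1 : ℕ) := by positivity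
  set θ := Real.pi / (n + 1 : ℕ) with hθ
  have hend : (((n : ℕ) : ℝ) + 1) * θ = Real.pi := by
    rw [hθ]
    push_cast
    field_simp
  have fn : (fun j : ℕ => Real.sin ((j + 1 : ℝ) * θ)) n = 0 := by simp [hend]
  refine .of_parent (f := fun j => Real.sin (((j : ℕ) + 1 : ℝ) * θ)) (by omega) ?_ ?_
    (fun j => j.bodd) ?_ ?_
  · intro i hi
    change i < n at hi
    have hi : (i : ℝ) < n := by exact_mod_cast hi
    have hθ0 : 0 < θ := by positivity
    refine Real.sin_pos_of_pos_of_lt_pi (by positivity) ?_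
    rw [← hend]
    nlinarith
  · intro i hi
    change i < n at hi
    change ∑ j ∈ Finset.range n, _ = _
    rw [← hθ]
    cases i with
    | zero =>
      rw [sum_ite_range_eq (s := {1}) fn]
      · simp only [Finset.sum_singleton]
        push_cast
        rw [show (1 + 1 : ℝ) * θ = 2 * θ by ring, Real.sin_two_mul]
        ring_nf
      · simp [Edge]; omega
      · simp; omega
    | succ i =>
      rw [sum_ite_range_eq (s := {i, i + 2}) fn]
      · rw [Finset.sum_pair (by omega)]
        push_cast
        rw [show ((i : ℝ) + 1) * θ = (i + 1 + 1) * θ - θ by ring,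
          show ((i : ℝ) + 2 + 1) * θ = (i + 1 + 1) * θ + θ by ring, Real.sin_sub, Real.sin_add]
        ring
      · simp [Edge]; omega
      · simp; omega
  · intro i j hij
    change (j : ℕ) = i + 1 at hij
    simp [hij]
  · intro j hj
    exact ⟨⟨j - 1, by omega⟩, by simp [Fin.lt_def]; omega, by simp [Edge]; omega⟩

/-- Along the arm `1, 3, 4, ...` the entries are `cos θ, cos 2θ, cos 3θ, ...`, and the two leaves
`0`, `2` share the preceding value `cos 0 = 1` equally. The choice of `h` makes the cosine vanish
just beyond the far end. -/
theorem hasPerronVector_D (n : ℕ) (hn : 4 ≤ n) : (D n hn).HasPerronVector (2 * n - 2)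
    (fun j => if (j : ℕ) = 0 ∨ (j : ℕ) = 2 then 1 / 2 else
      Real.cos ((if (j : ℕ) = 1 then 1 else (j : ℕ) - 1 : ℝ) *
        (Real.pi / (2 * n - 2 : ℕ)))) := by
  have hcast : (((2 * n - 2 : ℕ) : ℕ) : ℝ) = 2 * n - 2 := by
    rw [Nat.cast_sub (by omega)]
    push_cast
    ring
  have hn4 : (4 : ℝ) ≤ n := by exact_mod_cast hn
  set θ := Real.pi / (2 * n - 2 : ℕ) with hθ
  have hθ0 : 0 < θ := by
    rw [hθ, hcast]
    exact div_pos Real.pi_pos (by linarith)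
  have hend : ((n : ℝ) - 1) * θ = Real.pi / 2 := by
    rw [hθ, hcast]
    have : (n - 1 : ℝ) ≠ 0 := by linarith
    rw [show (2 * n - 2 : ℝ) = 2 * (n - 1) by ring]
    field_simp
  set f : ℕ → ℝ := fun j => if j = 0 ∨ j = 2 then 1 / 2 else
      Real.cos ((if j = 1 then 1 else (j : ℕ) - 1 : ℝ) * θ) with hf
  have f0 : f 0 = 1 / 2 := by simp [hf]
  have f1 : f 1 = Real.cos θ := by simp [hf]
  have f2 : f 2 = 1 / 2 := by simp [hf]
  have f3 : ∀ j : ℕ, f (j + 3) = Real.cos ((j + 2) * θ) := fun j => by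
    simp only [hf]
    rw [if_neg (by omega), if_neg (by omega)]
    push_cast
    congr 2
    ring
  have fn : f n = 0 := by
    obtain ⟨m, rfl⟩ : ∃ m, n = m + 3 := ⟨n - 3, by omega⟩
    rw [f3, show (m + 2 : ℝ) = (m + 3 : ℕ) - 1 by push_cast; ring, hend, Real.cos_pi_div_two]
  refine .of_parent (by omega) (f := f) ?_ ?_
    (fun j => if j < 3 then j.bodd else !j.bodd) ?_ ?_
  · intro i hi
    change i < n at hi
    match i, hi with
    | 0, _ => rw [f0]; norm_num
    | 1, _ => rw [f1]; exact Real.cos_pos_of_mem_Ioo ⟨by linarith [Real.pi_pos], by nlinarith⟩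
    | 2, _ => rw [f2]; norm_num
    | i + 3, hi =>
      have hi' : (i : ℝ) + 3 < n := by exact_mod_cast hi
      rw [f3]
      exact Real.cos_pos_of_mem_Ioo ⟨by nlinarith [Real.pi_pos], by nlinarith⟩
  · intro i hi
    change i < n at hi
    change ∑ j ∈ Finset.range n, _ = 2 * Real.cos θ * f i
    match i, hi with
    | 0, _ =>
      rw [sum_ite_range_eq (s := {1}) fn]
      · rw [Finset.sum_singleton, f0, f1]
        ring
      · simp [Edge]; omega
      · simp; omega
    | 1, _ =>
      rw [sum_ite_range_eq (s := {0, 2, 3}) fn]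
      · have := f3 0
        rw [Nat.cast_zero, zero_add, zero_add, Real.cos_two_mul] at this
        rw [Finset.sum_insert (by simp), Finset.sum_pair (by omega), f0, f1, f2, this]
        ring
      · simp [Edge]; omega
      · simp; omega
    | 2, _ =>
      rw [sum_ite_range_eq (s := {1}) fn]
      · rw [Finset.sum_singleton, f2, f1]
        ring
      · simp [Edge]; omega
      · simp; omega
    | 3, _ =>
      rw [sum_ite_range_eq (s := {1, 4}) fn]
      · rw [Finset.sum_pair (by omega), f1, f3 1, f3 0]
        push_cast
        rw [show (1 + 2 : ℝ) * θ = 2 * θ + θ by ring, zero_add, Real.cos_add,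
          Real.sin_two_mul, Real.cos_two_mul]
        have := Real.sin_sq_add_cos_sq θ
        linear_combination (-2 * Real.cos θ) * this
      · simp [Edge]; omega
      · simp; omega
    | i + 4, _ =>
      rw [sum_ite_range_eq (s := {i + 3, i + 5}) fn]
      · rw [Finset.sum_pair (by omega), f3 i, f3 (i + 1), f3 (i + 2)]
        push_cast
        rw [show ((i : ℝ) + 2) * θ = (i + 1 + 2) * θ - θ by ring,
          show ((i : ℝ) + 2 + 2) * θ = (i + 1 + 2) * θ + θ by ring, Real.cos_sub, Real.cos_add]
        ring
      · simp [Edge]; omega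
      · simp; omega
  · intro i j hij
    change ((j : ℕ) = i + 1 ∧ (j : ℕ) ≠ 3) ∨ ((i : ℕ) = 1 ∧ (j : ℕ) = 3) at hij
    rcases hij with ⟨h1, h2⟩ | ⟨h1, h2⟩
    · rw [h1] at h2 ⊢
      by_cases h3 : (i : ℕ) + 1 < 3
      · simp [h3, show (i : ℕ) < 3 by omega]
      · simp [h3, show ¬(i : ℕ) < 3 by omega]
    · simp [h1, h2]
  · intro j hj
    by_cases h3 : (j : ℕ) = 3
    · exact ⟨⟨1, by simp [rank]; omega⟩, by simp [Fin.lt_def]; omega, by simp [Edge]; omega⟩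
    · exact ⟨⟨j - 1, by omega⟩, by simp [Fin.lt_def]; omega, by simp [Edge]; omega⟩

/-- Used for the diagrams of type `E`, with `h = 2m`: the bound `t² > 3` gives positivity of the
entries, and the double-angle formula turns an equation for `cos (π / m)` into one for `t`. -/
theorem two_cos_pi_div_bounds {m : ℕ} (hm : 6 ≤ m) :
    0 < 2 * Real.cos (Real.pi / (2 * m : ℕ)) ∧ 3 < (2 * Real.cos (Real.pi / (2 * m : ℕ))) ^ 2 ∧
    (2 * Real.cos (Real.pi / (2 * m : ℕ))) ^ 2 = 2 * Real.cos (Real.pi / m) + 2 := by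
  have hm' : (6 : ℝ) ≤ m := by exact_mod_cast hm
  have hpi := Real.pi_pos
  have e : Real.pi / m = 2 * (Real.pi / (2 * m : ℕ)) := by
    push_cast
    field_simp
  have hm3 : Real.pi / m < Real.pi / 3 :=
    div_lt_div_of_pos_left hpi (by norm_num) (by linarith)
  have h1 : 0 < Real.pi / m := by positivity
  have h2 : (2 * Real.cos (Real.pi / (2 * m : ℕ))) ^ 2 = 2 * Real.cos (Real.pi / m) + 2 := by
    rw [e, Real.cos_two_mul]
    ring
  have h3 : Real.cos (Real.pi / 3) < Real.cos (Real.pi / m) :=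
    Real.cos_lt_cos_of_nonneg_of_le_pi_div_two h1.le (by linarith) hm3
  rw [Real.cos_pi_div_three] at h3
  exact ⟨mul_pos two_pos (Real.cos_pos_of_mem_Ioo ⟨by linarith, by linarith⟩),
    by linarith, h2⟩

theorem exists_hasPerronVector_E6 : ∃ v, (E6).HasPerronVector 12 v := by
  obtain ⟨h0, h3, h2⟩ := two_cos_pi_div_bounds (m := 6) le_rfl
  simp only [Nat.reduceMul] at h0 h3 h2
  set t := 2 * Real.cos (Real.pi / (12 : ℕ)) with ht
  have hz : Real.cos (Real.pi / (6 : ℕ)) ^ 2 = 3 / 4 := by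
    push_cast
    rw [Real.cos_pi_div_six, div_pow, Real.sq_sqrt] <;> norm_num
  have hpoly : t ^ 4 - 4 * t ^ 2 + 1 = 0 := by
    rw [show t ^ 4 = (t ^ 2) ^ 2 by ring, h2]
    linear_combination 4 * hz
  -- The entries solve the eigenvector equation from each leaf inwards, scaled to agree at the
  -- branch vertex. Only the equation at the branch vertex is not an identity in `t`; it is `hpoly`.
  -- The same scheme gives the vectors for `E7` and `E8`.
  refine ⟨_, .of_parent (f := fun j => [t, t ^ 2, t * (t ^ 2 - 1), t ^ 2, t, t ^ 2 - 1].getD j 0)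
    (by omega) ?_ ?_
    (fun j => if j = 5 then true else j.bodd) (by decide) (by decide)⟩
  · have : 0 < t ^ 2 - 1 := by linarith
    intro i hi
    change i < 6 at hi
    interval_cases i <;> simp [-one_lt_sq_iff_one_lt_abs] <;> first | positivity | linarith
  · intro i hi
    change i < 6 at hi
    change ∑ j ∈ Finset.range 6, _ = t * _
    simp only [Finset.sum_range_succ, Finset.sum_range_zero]
    interval_cases i <;> simp [Edge] <;>
      first | ring1 | linear_combination hpoly | linear_combination -hpoly

theorem exists_hasPerronVector_E7 : ∃ v, (E7).HasPerronVector 18 v := by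
  obtain ⟨h0, h3, h2⟩ := two_cos_pi_div_bounds (m := 9) (by norm_num)
  simp only [Nat.reduceMul] at h0 h3 h2
  set t := 2 * Real.cos (Real.pi / (18 : ℕ)) with ht
  have hz := Real.cos_three_mul (Real.pi / (9 : ℕ))
  rw [show 3 * (Real.pi / (9 : ℕ)) = Real.pi / 3 by push_cast; ring, Real.cos_pi_div_three] at hz
  have hpoly : t ^ 6 - 6 * t ^ 4 + 9 * t ^ 2 - 3 = 0 := by
    rw [show t ^ 6 = (t ^ 2) ^ 3 by ring, show t ^ 4 = (t ^ 2) ^ 2 by ring, h2]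
    linear_combination -2 * hz
  refine ⟨_, .of_parent (f := fun j => [t ^ 2 - 1, t * (t ^ 2 - 1), (t ^ 2 - 1) ^ 2,
    t * (t ^ 2 - 2) * (t ^ 2 - 1),
    t ^ 2 * (t ^ 2 - 2), t * (t ^ 2 - 2), (t ^ 2 - 2) * (t ^ 2 - 1)].getD j 0)
    (by omega) ?_ ?_
    (fun j => if j = 6 then false else j.bodd) (by decide) (by decide)⟩
  · have h4 : 0 < t ^ 2 - 1 := by linarith
    have h5 : 0 < t ^ 2 - 2 := by linarith
    intro i hi
    change i < 7 at hi
    interval_cases i <;> simp [-one_lt_sq_iff_one_lt_abs] <;> first | positivity | linarith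
  · intro i hi
    change i < 7 at hi
    change ∑ j ∈ Finset.range 7, _ = t * _
    simp only [Finset.sum_range_succ, Finset.sum_range_zero]
    interval_cases i <;> simp [Edge] <;>
      first | ring1 | linear_combination hpoly | linear_combination -hpoly

theorem exists_hasPerronVector_E8 : ∃ v, (E8).HasPerronVector 30 v := by
  obtain ⟨h0, h3, h2⟩ := two_cos_pi_div_bounds (m := 15) (by norm_num)
  simp only [Nat.reduceMul] at h0 h3 h2
  set t := 2 * Real.cos (Real.pi / (30 : ℕ)) with ht
  set z := Real.cos (Real.pi / (15 : ℕ)) with hz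
  have h5 : 16 * z ^ 5 - 20 * z ^ 3 + 5 * z = 1 / 2 := by
    rw [← Real.cos_pi_div_three,
      show Real.pi / 3 = 2 * (Real.pi / (15 : ℕ)) + 3 * (Real.pi / (15 : ℕ)) by push_cast; ring,
      Real.cos_add, Real.cos_two_mul, Real.cos_three_mul, Real.sin_two_mul, Real.sin_three_mul,
      ← hz]
    have := Real.sin_sq_add_cos_sq (Real.pi / (15 : ℕ))
    rw [← hz] at this
    set s := Real.sin (Real.pi / (15 : ℕ))
    linear_combination (6 * z - 8 * z * (s ^ 2 - z ^ 2 + 1)) * this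
  have hpoly : t ^ 8 - 7 * t ^ 6 + 14 * t ^ 4 - 8 * t ^ 2 + 1 = 0 := by
    -- The quintic `h5`, which says `cos (5 π / 15) = 1 / 2`, also has the root `1 / 2`. As `t² > 3`
    -- gives `z > 1 / 2`, the factor `2 z - 1` can be cancelled, leaving the quartic that becomes
    -- `hpoly`.
    have hz1 : 2 * z - 1 ≠ 0 := by linarith
    refine mul_left_cancel₀ hz1 ?_
    rw [show t ^ 6 = (t ^ 2) ^ 3 by ring, show t ^ 8 = (t ^ 2) ^ 4 by ring,
      show t ^ 4 = (t ^ 2) ^ 2 by ring, h2]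
    linear_combination 2 * h5
  refine ⟨_, .of_parent (f := fun j => [t * (t ^ 2 - 1), t ^ 2 * (t ^ 2 - 1), t * (t ^ 2 - 1) ^ 2,
    t ^ 2 * (t ^ 2 - 2) * (t ^ 2 - 1), t * (t ^ 2 - 1) * (t ^ 4 - 3 * t ^ 2 + 1),
    t ^ 2 * (t ^ 4 - 3 * t ^ 2 + 1), t * (t ^ 4 - 3 * t ^ 2 + 1),
    (t ^ 2 - 1) * (t ^ 4 - 3 * t ^ 2 + 1)].getD j 0)
    (by omega) ?_ ?_
    (fun j => if j = 7 then true else j.bodd) (by decide) (by decide)⟩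
  · have h4 : 0 < t ^ 2 - 1 := by linarith
    have h5 : 0 < t ^ 2 - 2 := by linarith
    have h6 : 0 < t ^ 4 - 3 * t ^ 2 + 1 := by nlinarith
    intro i hi
    change i < 8 at hi
    interval_cases i <;> simp <;> positivity
  · intro i hi
    change i < 8 at hi
    change ∑ j ∈ Finset.range 8, _ = t * _
    simp only [Finset.sum_range_succ, Finset.sum_range_zero]
    interval_cases i <;> simp [Edge] <;>
      first | ring1 | linear_combination hpoly | linear_combination -hpoly

theorem exists_hasPerronVector (Γ : ADEDiagram) : ∃ h v, Γ.HasPerronVector h v :=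
  match Γ with
  | A n hn => ⟨_, _, hasPerronVector_A n hn⟩
  | D n hn => ⟨_, _, hasPerronVector_D n hn⟩
  | E6 => ⟨_, exists_hasPerronVector_E6⟩
  | E7 => ⟨_, exists_hasPerronVector_E7⟩
  | E8 => ⟨_, exists_hasPerronVector_E8⟩

end ADEDiagram

end

/-! ### Frobenius-Perron dimensions, hypergroups from characters, and generators of the Verlinde
ring -/

noncomputable section
open Matrix Polynomial

section Character

variable {R : Type} [Ring R] {I : Type} [Fintype I] [DecidableEq I] (F : FusionRing R I)
  (χ : R →+* ℝ)

theorem FusionRing.sum_map_basis_mul (i j : I) :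
    ∑ k, (F.basis.repr (F.basis i * F.basis j) k : ℝ) * χ (F.basis k) =
      χ (F.basis i) * χ (F.basis j) := by
  rw [← map_mul χ]
  conv_rhs => rw [← F.basis.sum_repr (F.basis i * F.basis j)]
  simp [map_sum, zsmul_eq_mul]

/-- A character that is positive on the basis is the Frobenius-Perron dimension. -/
theorem FusionRing.FPdim_eq (hχ : ∀ i, 0 < χ (F.basis i)) (i : I) :
    F.FPdim i = χ (F.basis i) := by
  set N := (F.leftMulMatrix i).map (Int.cast : ℤ → ℝ) with hN
  set d : I → ℝ := fun k => χ (F.basis k) with hd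
  have hN0 : ∀ k j, 0 ≤ N k j := fun k j => by
    simpa [hN, FusionRing.leftMulMatrix] using F.nonneg i j k
  -- Multiplicativity of `χ` says that its values form a positive left eigenvector of `N_i`; the
  -- determinant then converts this into a right eigenvector for the same eigenvalue.
  have hdN : d ᵥ* N = d i • d := by
    ext j
    rw [Pi.smul_apply, smul_eq_mul, ← F.sum_map_basis_mul χ i j]
    simp [vecMul, dotProduct, hN, FusionRing.leftMulMatrix, hd, mul_comm]
  have hd0 : d ≠ 0 := fun h => (hχ i).ne' (congrFun h i)
  refine IsGreatest.csSup_eq ⟨?_, ?_⟩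
  · have hdet : (N - d i • (1 : Matrix I I ℝ)).det = 0 :=
      exists_vecMul_eq_zero_iff.1 ⟨d, hd0, by
        rw [vecMul_sub, hdN, vecMul_smul, vecMul_one, sub_self]⟩
    obtain ⟨w, hw0, hw⟩ := exists_mulVec_eq_zero_iff.2 hdet
    refine Module.End.hasEigenvalue_of_hasEigenvector (x := w)
      ⟨Module.End.mem_eigenspace_iff.2 ?_, hw0⟩
    rw [sub_mulVec, smul_mulVec, one_mulVec, sub_eq_zero] at hw
    rw [toLin'_apply, hw]
  · rintro t ht
    obtain ⟨w, hw, hw0⟩ := ht.exists_hasEigenvector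
    rw [Module.End.mem_eigenspace_iff, toLin'_apply] at hw
    have hpos : 0 < ∑ k, d k * |w k| := by
      obtain ⟨k, hk⟩ := Function.ne_iff.1 hw0
      exact Finset.sum_pos' (fun k _ => mul_nonneg (hχ k).le (abs_nonneg _))
        ⟨k, Finset.mem_univ k, mul_pos (hχ k) (abs_pos.2 hk)⟩
    -- Pairing absolute values of an eigenvector with the positive left eigenvector `d` bounds every
    -- real eigenvalue by `d i`.
    have hle : t * ∑ k, d k * |w k| ≤ d i * ∑ k, d k * |w k| := by
      calc t * ∑ k, d k * |w k| ≤ |t| * ∑ k, d k * |w k| :=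
            mul_le_mul_of_nonneg_right (le_abs_self t) hpos.le
        _ = ∑ k, d k * |∑ j, N k j * w j| := by
            rw [Finset.mul_sum]
            refine Finset.sum_congr rfl fun k _ => ?_
            have : ∑ j, N k j * w j = t * w k := congrFun hw k
            rw [this, abs_mul]
            ring
        _ ≤ ∑ k, d k * ∑ j, N k j * |w j| := by
            refine Finset.sum_le_sum fun k _ => mul_le_mul_of_nonneg_left ?_ (hχ k).le
            refine (Finset.abs_sum_le_sum_abs _ _).trans_eq (Finset.sum_congr rfl fun j _ => ?_)
            rw [abs_mul, abs_of_nonneg (hN0 k j)]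
        _ = (d ᵥ* N) ⬝ᵥ fun j => |w j| := by rw [← dotProduct_mulVec]; rfl
        _ = d i * ∑ k, d k * |w k| := by rw [hdN, smul_dotProduct, smul_eq_mul]; rfl
    exact le_of_mul_le_mul_right hle hpos

end Character

section Hypergroup

variable {R : Type} [CommRing R] {I : Type} [Fintype I] [DecidableEq I] (F : FusionRing R I)
  (χ : R →+* ℝ) (hχ : ∀ i, 0 < χ (F.basis i))

/-- The rescaled basis `b_i / χ(b_i)` of `ℝ ⊗ R`. -/
def FusionRing.normalizedBasis : Module.Basis I ℝ (ℝ ⊗[ℤ] R) :=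
  (Algebra.TensorProduct.basis ℝ F.basis).unitsSMul fun i =>
    Units.mk0 (χ (F.basis i))⁻¹ (inv_ne_zero (hχ i).ne')

theorem FusionRing.normalizedBasis_apply (i : I) :
    F.normalizedBasis χ hχ i = (χ (F.basis i))⁻¹ • ((1 : ℝ) ⊗ₜ[ℤ] F.basis i) := by
  simp [FusionRing.normalizedBasis, Module.Basis.unitsSMul_apply, Units.smul_def]

theorem FusionRing.normalizedBasis_repr_mul (i j k : I) :
    (F.normalizedBasis χ hχ).repr (F.normalizedBasis χ hχ i * F.normalizedBasis χ hχ j) k =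
      (χ (F.basis i))⁻¹ * (χ (F.basis j))⁻¹ *
        (F.basis.repr (F.basis i * F.basis j) k * χ (F.basis k)) := by
  rw [F.normalizedBasis_apply, F.normalizedBasis_apply, smul_mul_smul_comm,
    Algebra.TensorProduct.tmul_mul_tmul, one_mul, map_smul, Finsupp.smul_apply,
    FusionRing.normalizedBasis, Module.Basis.repr_unitsSMul,
    Algebra.TensorProduct.basis_repr_tmul]
  simp [Units.smul_def, mul_comm]

/-- The hypergroup of a commutative fusion ring with a positive character and trivial
involution. -/
def FusionRing.toHypergroup (hstar : ∀ i, F.star i = i) : Hypergroup (ℝ ⊗[ℤ] R) I where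
  basis := F.normalizedBasis χ hχ
  unit := F.unit
  star i := i
  basis_unit := by
    rw [F.normalizedBasis_apply, F.basis_unit, map_one, inv_one, one_smul]
    rfl
  nonneg i j k := by
    rw [F.normalizedBasis_repr_mul]
    have := hχ i
    have := hχ j
    have := hχ k
    have : (0 : ℝ) ≤ F.basis.repr (F.basis i * F.basis j) k := by exact_mod_cast F.nonneg i j k
    positivity
  sum_eq_one i j := by
    simp only [F.normalizedBasis_repr_mul]
    rw [← Finset.mul_sum, F.sum_map_basis_mul χ i j]
    have := (hχ i).ne'
    have := (hχ j).ne'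
    field_simp
  star_star i := rfl
  star_anti := ⟨AlgEquiv.toOpposite ℝ _, fun i => rfl⟩
  unit_coeff_comm i j := by rw [mul_comm]
  unit_coeff_pos i j := by
    rw [F.normalizedBasis_repr_mul, F.unit_coeff, hstar, F.basis_unit, map_one]
    have := hχ i
    have := hχ j
    by_cases hij : i = j
    · simp only [hij, if_true, iff_true]
      simp
      positivity
    · simp [hij, Ne.symm hij]

end Hypergroup

section Verlinde

variable {n : ℕ}

/-- The ring homomorphism from the Verlinde ring to a possibly non-commutative ring. -/
def verlindeLift {S : Type} [Ring S] (a : S) (ha : aeval a (Chebyshev.S ℤ n) = 0) :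
    VerlindeRing n →+* S :=
  RingHom.liftOfSurjective (AdjoinRoot.mk (Chebyshev.S ℤ n)) AdjoinRoot.mk_surjective
    ⟨(aeval a).toRingHom, fun p hp => by
      obtain ⟨q, rfl⟩ := AdjoinRoot.mk_eq_zero.1 hp
      rw [RingHom.mem_ker]
      change aeval a _ = 0
      rw [map_mul, ha, zero_mul]⟩

theorem verlindeLift_delta {S : Type} [Ring S] (a : S) (ha : aeval a (Chebyshev.S ℤ n) = 0)
    (k : ℕ) : verlindeLift a ha (verlindeDelta n k) = aeval a (Chebyshev.S ℤ k) :=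
  RingHom.liftOfRightInverse_comp_apply _ _ _ _ _

theorem verlindeDelta_zero : verlindeDelta n 0 = 1 := by simp [verlindeDelta]

theorem verlindeDelta_self : verlindeDelta n n = 0 := AdjoinRoot.mk_self

theorem verlindeDelta_add_two (k : ℕ) : verlindeDelta n (k + 2) =
    AdjoinRoot.root _ * verlindeDelta n (k + 1) - verlindeDelta n k := by
  simp [verlindeDelta, Chebyshev.S_add_two]

theorem verlindeDelta_one : verlindeDelta n 1 = AdjoinRoot.root _ := by simp [verlindeDelta]

/-- By the recurrence the span is closed under multiplication by `x`, with `Δ_n = 0` closing it at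
the top; it contains `1`, hence all powers of `x`. -/
theorem span_verlindeDelta (hn : 1 ≤ n) :
    Submodule.span ℤ (Set.range fun k : Fin n => verlindeDelta n k) = ⊤ := by
  set M := Submodule.span ℤ (Set.range fun k : Fin n => verlindeDelta n k) with hM
  have hmem : ∀ k ≤ n, verlindeDelta n k ∈ M := fun k hk => by
    rcases lt_or_eq_of_le hk with h | rfl
    · exact Submodule.subset_span ⟨⟨k, h⟩, rfl⟩
    · rw [verlindeDelta_self]
      exact M.zero_mem
  have hroot : ∀ x ∈ M, AdjoinRoot.root _ * x ∈ M := fun x hx => by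
    induction hx using Submodule.span_induction with
    | mem x hx =>
      obtain ⟨⟨k, hk⟩, rfl⟩ := hx
      cases k with
      | zero =>
        change _ * verlindeDelta n 0 ∈ M
        rw [verlindeDelta_zero, mul_one, ← verlindeDelta_one]
        exact hmem 1 hn
      | succ k =>
        have := verlindeDelta_add_two (n := n) k
        change _ * verlindeDelta n (k + 1) ∈ M
        rw [← add_eq_of_eq_sub this]
        exact M.add_mem (hmem _ hk) (hmem _ (by omega))
    | zero => simp
    | add x y _ _ hx hy => rw [mul_add]; exact M.add_mem hx hy
    | smul r x _ hx => rw [mul_smul_comm]; exact M.smul_mem r hx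
  refine Submodule.eq_top_iff'.2 fun x => ?_
  obtain ⟨p, rfl⟩ := AdjoinRoot.mk_surjective x
  have hX : ∀ k : ℕ, AdjoinRoot.root _ ^ k ∈ M := fun k => by
    induction k with
    | zero =>
      rw [pow_zero, ← verlindeDelta_zero]
      exact hmem 0 (Nat.zero_le n)
    | succ k ih => rw [pow_succ']; exact hroot _ ih
  induction p using Polynomial.induction_on' with
  | add p q hp hq => rw [map_add]; exact M.add_mem hp hq
  | monomial k a =>
    rw [← smul_X_eq_monomial, ← AdjoinRoot.smul_mk, map_pow, AdjoinRoot.mk_X]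
    exact M.smul_mem a (hX k)

end Verlinde

namespace ADEDiagram

variable {Γ : ADEDiagram} {v : Γ.V}

theorem map_aeval_adjMatrix (Γ : ADEDiagram) (k : ℤ) :
    (aeval (Γ.graph.adjMatrix ℤ) (Chebyshev.S ℤ k)).map (Int.cast : ℤ → ℝ) = Γ.chebMatrix k := by
  have h := aeval_algHom_apply ((Int.castRingHom ℝ).mapMatrix (m := Fin Γ.rank)).toIntAlgHom
    (Γ.graph.adjMatrix ℤ) (Chebyshev.S ℤ k)
  have h2 : (Int.castRingHom ℝ).mapMatrix (Γ.graph.adjMatrix ℤ) = Γ.graph.adjMatrix ℝ := by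
    ext i j
    simp [SimpleGraph.adjMatrix_apply]
  change aeval ((Int.castRingHom ℝ).mapMatrix _) _ = _ at h
  rw [h2] at h
  exact h.symm

theorem aeval_adjMatrix_apply (Γ : ADEDiagram) (k : ℤ) (i j : Fin Γ.rank) :
    ((aeval (Γ.graph.adjMatrix ℤ) (Chebyshev.S ℤ k) i j : ℤ) : ℝ) = Γ.chebMatrix k i j := by
  rw [← map_aeval_adjMatrix]
  rfl

theorem HasPerronVector.aeval_eq_zero {n : ℕ} (H : Γ.HasPerronVector (n + 1) v) :
    aeval (Γ.graph.adjMatrix ℤ) (Chebyshev.S ℤ n) = 0 := by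
  have := H.chebMatrix_pred_eq_zero
  push_cast at this
  rw [add_sub_cancel_right] at this
  ext i j
  have h2 := Γ.aeval_adjMatrix_apply n i j
  rw [this] at h2
  simpa using h2

theorem HasPerronVector.aeval_nonneg {h : ℕ} (H : Γ.HasPerronVector h v) {k : ℕ} (hk : k < h)
    (i j : Fin Γ.rank) : 0 ≤ aeval (Γ.graph.adjMatrix ℤ) (Chebyshev.S ℤ k) i j := by
  have h1 := H.chebMatrix_nonneg k hk i j
  rw [← aeval_adjMatrix_apply] at h1
  exact_mod_cast h1

theorem aeval_adjMatrix_apply_comm (Γ : ADEDiagram) (k : ℕ)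
    (i j : Fin Γ.rank) : aeval (Γ.graph.adjMatrix ℤ) (Chebyshev.S ℤ k) i j =
      aeval (Γ.graph.adjMatrix ℤ) (Chebyshev.S ℤ k) j i := by
  have h1 := congrFun (congrFun (Γ.chebMatrix_transpose k) i) j
  rw [transpose_apply, ← aeval_adjMatrix_apply, ← aeval_adjMatrix_apply] at h1
  exact_mod_cast h1.symm

end ADEDiagram

end

/-! ### The path as regular representation, and the fusion rings -/

noncomputable section
open Matrix Polynomial

/-- The adjacency matrix of the path with `n` vertices. -/
def pathMatrix {n : ℕ} (hn : 1 ≤ n) : Matrix (Fin n) (Fin n) ℤ :=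
  (ADEDiagram.A n hn).graph.adjMatrix ℤ

/-- The element `Δ_{2k}` of the even part. -/
def evenDelta (n : ℕ) (k : Fin ((n - 1) / 2 + 1)) : verlindeEven n :=
  ⟨verlindeDelta n (2 * k), Subring.subset_closure ⟨k, by omega, rfl⟩⟩

section Path

variable {n : ℕ} (hn : 1 ≤ n)

theorem pathMatrix_apply (i j : Fin n) :
    pathMatrix hn i j = if (j : ℕ) = i + 1 ∨ (i : ℕ) = j + 1 then 1 else 0 := by
  have h : (ADEDiagram.A n hn).graph.Adj i j ↔ (j : ℕ) = i + 1 ∨ (i : ℕ) = j + 1 := by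
    refine ADEDiagram.adj_iff.trans ⟨fun h => h.2, fun h => ⟨?_, h⟩⟩
    rintro rfl
    omega
  by_cases hij : (ADEDiagram.A n hn).graph.Adj i j
  · rw [if_pos (h.1 hij)]
    exact if_pos hij
  · rw [if_neg (mt h.2 hij)]
    exact if_neg hij

/-- The matrix by which `Δ_k` acts on the path with `n` vertices. -/
def pathCheb (k : ℕ) : Matrix (Fin n) (Fin n) ℤ :=
  aeval (pathMatrix hn) (Chebyshev.S ℤ k)

theorem aeval_pathMatrix_eq_zero : aeval (pathMatrix hn) (Chebyshev.S ℤ n) = 0 :=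
  (ADEDiagram.hasPerronVector_A n hn).aeval_eq_zero

theorem pathCheb_nonneg {k : ℕ} (hk : k < n + 1) (i j : Fin n) : 0 ≤ pathCheb hn k i j :=
  (ADEDiagram.hasPerronVector_A n hn).aeval_nonneg hk i j

theorem pathCheb_apply_comm (k : ℕ) (i j : Fin n) :
    pathCheb hn k i j = pathCheb hn k j i :=
  (ADEDiagram.A n hn).aeval_adjMatrix_apply_comm k i j

theorem pathCheb_add_two (k : ℕ) :
    pathCheb hn (k + 2) = pathMatrix hn * pathCheb hn (k + 1) - pathCheb hn k := by
  simp [pathCheb, Chebyshev.S_add_two]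

/-- The first vertex of the path generates the regular representation. -/
theorem pathCheb_apply_zero (k : ℕ) (hk : k < n) :
    (fun i => pathCheb hn k i ⟨0, hn⟩) = Pi.single (⟨k, hk⟩ : Fin n) (1 : ℤ) := by
  induction k using Nat.twoStepInduction with
  | zero =>
    ext i
    simp [pathCheb, Matrix.one_apply, Pi.single_apply]
  | one =>
    ext i
    simp only [pathCheb, Nat.cast_one, Chebyshev.S_one, aeval_X, pathMatrix_apply,
      Pi.single_apply, Fin.ext_iff]
    refine if_congr ?_ rfl rfl
    omega
  | more k h0 h1 =>
    ext i
    have h0 := congrFun (h0 (by omega)) i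
    have h1 := h1 (by omega)
    rw [pathCheb_add_two, Matrix.sub_apply, h0, Matrix.mul_apply']
    rw [h1, dotProduct_single_one, pathMatrix_apply]
    simp only [Pi.single_apply, Fin.ext_iff]
    split_ifs <;> omega

/-- The regular representation of the Verlinde ring, on the path. -/
def verlindeRegular : VerlindeRing n →+* Matrix (Fin n) (Fin n) ℤ :=
  verlindeLift (pathMatrix hn) (aeval_pathMatrix_eq_zero hn)

theorem verlindeRegular_delta (k : ℕ) :
    verlindeRegular hn (verlindeDelta n k) = pathCheb hn k :=
  verlindeLift_delta _ _ k

/-- The coordinates in the basis `Δ_k`. -/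
def verlindeCoord : VerlindeRing n →ₗ[ℤ] Fin n → ℤ where
  toFun x i := verlindeRegular hn x i ⟨0, hn⟩
  map_add' x y := by
    ext i
    simp
  map_smul' r x := by
    rw [map_zsmul]
    rfl

theorem verlindeCoord_delta (k : Fin n) :
    verlindeCoord hn (verlindeDelta n k) = Pi.single k 1 := by
  rw [← pathCheb_apply_zero hn k k.2]
  ext i
  change verlindeRegular hn _ _ _ = _
  rw [verlindeRegular_delta]

/-- `Δ_j` carries the first vertex of the path to vertex `j`. Structure constants are therefore
matrix entries on the path, and their non-negativity is the type `A` case of `chebMatrix_nonneg`. -/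
theorem verlindeCoord_mul_delta (x : VerlindeRing n) (j k : Fin n) :
    verlindeCoord hn (x * verlindeDelta n j) k = verlindeRegular hn x k j := by
  change verlindeRegular hn _ _ _ = _
  rw [map_mul, Matrix.mul_apply', verlindeRegular_delta, pathCheb_apply_zero hn j j.2,
    dotProduct_single_one]

/-- The basis `Δ_k` of the Verlinde ring. -/
def verlindeBasis : Module.Basis (Fin n) ℤ (VerlindeRing n) :=
  Module.Basis.mk (v := fun k : Fin n => verlindeDelta n k)
    (by
      refine LinearIndependent.of_comp (verlindeCoord hn) ?_
      have : verlindeCoord hn ∘ (fun k : Fin n => verlindeDelta n k) =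
          fun k => Pi.single k 1 := funext fun k => verlindeCoord_delta hn k
      rw [this]
      exact Pi.linearIndependent_single_one (Fin n) ℤ)
    (span_verlindeDelta hn).ge

theorem verlindeBasis_apply (k : Fin n) : verlindeBasis hn k = verlindeDelta n k := by
  simp [verlindeBasis]

theorem verlindeBasis_repr (x : VerlindeRing n) (k : Fin n) :
    (verlindeBasis hn).repr x k = verlindeCoord hn x k := by
  have : Finsupp.lapply k ∘ₗ (verlindeBasis hn).repr.toLinearMap =
      LinearMap.proj k ∘ₗ verlindeCoord hn := by
    refine (verlindeBasis hn).ext fun i => ?_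
    simp only [LinearMap.comp_apply, LinearEquiv.coe_coe, Module.Basis.repr_self,
      Finsupp.lapply_apply, LinearMap.proj_apply]
    rw [verlindeBasis_apply, verlindeCoord_delta]
    simp [Finsupp.single_apply, Pi.single_apply, eq_comm]
  exact LinearMap.congr_fun this x

/-- The Verlinde ring as a fusion ring. -/
def verlindeFusion : FusionRing (VerlindeRing n) (Fin n) where
  basis := verlindeBasis hn
  unit := ⟨0, hn⟩
  star i := i
  basis_unit := by rw [verlindeBasis_apply]; exact verlindeDelta_zero
  nonneg i j k := by
    rw [verlindeBasis_repr, verlindeBasis_apply, verlindeBasis_apply, verlindeCoord_mul_delta,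
      verlindeRegular_delta]
    exact pathCheb_nonneg hn (by omega) _ _
  star_star _ := rfl
  star_anti := ⟨RingEquiv.toOpposite _, fun _ => rfl⟩
  unit_coeff i j := by
    rw [verlindeBasis_repr, verlindeBasis_apply, verlindeBasis_apply, verlindeCoord_mul_delta,
      verlindeRegular_delta, pathCheb_apply_comm]
    have := congrFun (pathCheb_apply_zero hn i i.2) j
    rw [this]
    simp [Pi.single_apply, eq_comm]

/-- The path matrix changes the parity of the index. This parity keeps the even part of the Verlinde
ring inside the span of the `Δ_{2k}`. -/
theorem pathCheb_apply_eq_zero (k : ℕ) (i j : Fin n) (h : Odd (i + j + k : ℕ)) :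
    pathCheb hn k i j = 0 := by
  induction k using Nat.twoStepInduction generalizing i with
  | zero =>
    have : i ≠ j := by
      rintro rfl
      rw [Nat.odd_iff] at h
      omega
    simp [pathCheb, this]
  | one =>
    simp only [pathCheb, Nat.cast_one, Chebyshev.S_one, aeval_X, pathMatrix_apply]
    rw [if_neg]
    rw [Nat.odd_iff] at h
    omega
  | more k h0 h1 =>
    rw [pathCheb_add_two, Matrix.sub_apply, Matrix.mul_apply,
      h0 i (by rw [Nat.odd_iff] at h ⊢; omega), sub_zero]
    refine Finset.sum_eq_zero fun u _ => ?_
    rw [pathMatrix_apply]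
    split_ifs with hu
    · rw [h1 u (by rw [Nat.odd_iff] at h ⊢; omega), mul_zero]
    · rw [zero_mul]

/-- The index `2 k` of an element of the basis of the even part. -/
def evenIndex (k : Fin ((n - 1) / 2 + 1)) : Fin n := ⟨2 * k, by omega⟩

theorem evenIndex_injective : Function.Injective (evenIndex hn) := fun i j h => by
  simpa [evenIndex, Fin.ext_iff] using h

theorem exists_evenIndex_eq (i : Fin n) (hi : Even (i : ℕ)) : ∃ k, evenIndex hn k = i := by
  obtain ⟨r, hr⟩ := hi
  refine ⟨⟨r, by omega⟩, Fin.ext ?_⟩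
  simp [evenIndex, hr, two_mul]

theorem verlindeCoord_eq_zero {x : VerlindeRing n} (hx : x ∈ verlindeEven n) (i : Fin n)
    (hi : Odd (i : ℕ)) : verlindeCoord hn x i = 0 := by
  -- Vanishing of all odd entries of the matrix, rather than only of its first column, is preserved
  -- by products.
  suffices h : ∀ i j : Fin n, Odd (i + j : ℕ) → verlindeRegular hn x i j = 0 from
    h i ⟨0, hn⟩ (by simpa using hi)
  induction hx using Subring.closure_induction with
  | mem x hx =>
    obtain ⟨k, hk, rfl⟩ := hx
    intro i j hij
    rw [verlindeRegular_delta, pathCheb_apply_eq_zero]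
    rw [Nat.odd_iff] at hij ⊢
    omega
  | zero => simp
  | one =>
    intro i j hij
    have : i ≠ j := by
      rintro rfl
      rw [Nat.odd_iff] at hij
      omega
    simp [this]
  | add x y _ _ hx hy =>
    intro i j hij
    rw [map_add, Matrix.add_apply, hx i j hij, hy i j hij, add_zero]
  | neg x _ hx =>
    intro i j hij
    rw [map_neg, Matrix.neg_apply, hx i j hij, neg_zero]
  | mul x y _ _ hx hy =>
    intro i j hij
    rw [map_mul, Matrix.mul_apply]
    refine Finset.sum_eq_zero fun u _ => ?_
    rcases Nat.even_or_odd (i + u : ℕ) with h | h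
    · rw [hy u j (by rw [Nat.odd_iff] at hij ⊢; rw [Nat.even_iff] at h; omega), mul_zero]
    · rw [hx i u h, zero_mul]

/-- The basis `Δ_{2k}` of the even part of the Verlinde ring. -/
def evenBasis :
    Module.Basis (Fin ((n - 1) / 2 + 1)) ℤ (verlindeEven n) :=
  Module.Basis.mk (v := evenDelta n)
    (by
      have h := (verlindeBasis hn).linearIndependent.comp _ (evenIndex_injective hn)
      refine LinearIndependent.of_comp
        ((verlindeEven n).subtype.toIntAlgHom.toLinearMap) ?_
      have he : (verlindeEven n).subtype.toIntAlgHom.toLinearMap ∘ evenDelta n =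
          verlindeBasis hn ∘ evenIndex hn := by
        ext k
        rw [Function.comp_apply, Function.comp_apply, verlindeBasis_apply]
        rfl
      rw [he]
      exact h)
    (by
      rintro ⟨x, hx⟩ -
      have hsum : (⟨x, hx⟩ : verlindeEven n) =
          ∑ k, verlindeCoord hn x (evenIndex hn k) • evenDelta n k := by
        refine Subtype.ext ?_
        have h1 := (verlindeBasis hn).sum_repr x
        simp only [verlindeBasis_repr, verlindeBasis_apply] at h1
        have h2 : ((∑ k, verlindeCoord hn x (evenIndex hn k) • evenDelta n k :
            verlindeEven n) : VerlindeRing n) =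
            ∑ k, verlindeCoord hn x (evenIndex hn k) • verlindeDelta n (evenIndex hn k) := by
          simp [evenDelta, evenIndex]
        rw [h2]
        refine h1.symm.trans ?_
        rw [← Finset.sum_image (s := Finset.univ) (g := evenIndex hn)
          (f := fun i => verlindeCoord hn x i • verlindeDelta n i)
          (fun i _ j _ h => evenIndex_injective hn h)]
        refine (Finset.sum_subset (Finset.subset_univ _) fun i _ hi => ?_).symm
        rw [verlindeCoord_eq_zero hn hx, zero_smul]
        rw [← Nat.not_even_iff_odd]
        intro he
        obtain ⟨k, hk⟩ := exists_evenIndex_eq hn i he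
        exact hi (Finset.mem_image.2 ⟨k, Finset.mem_univ k, hk⟩)
      rw [hsum]
      exact Submodule.sum_mem _ fun k _ => Submodule.smul_mem _ _
        (Submodule.subset_span ⟨k, rfl⟩))

theorem evenBasis_apply (k : Fin ((n - 1) / 2 + 1)) : evenBasis hn k = evenDelta n k := by
  simp [evenBasis]

theorem evenBasis_repr (x : verlindeEven n) (k : Fin ((n - 1) / 2 + 1)) :
    (evenBasis hn).repr x k = verlindeCoord hn x (evenIndex hn k) := by
  have : Finsupp.lapply k ∘ₗ (evenBasis hn).repr.toLinearMap =
      LinearMap.proj (evenIndex hn k) ∘ₗ verlindeCoord hn ∘ₗ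
        (verlindeEven n).subtype.toIntAlgHom.toLinearMap := by
    refine (evenBasis hn).ext fun i => ?_
    simp only [LinearMap.comp_apply, LinearEquiv.coe_coe, Module.Basis.repr_self,
      Finsupp.lapply_apply, LinearMap.proj_apply]
    rw [evenBasis_apply]
    change _ = verlindeCoord hn (verlindeDelta n (evenIndex hn i)) (evenIndex hn k)
    rw [verlindeCoord_delta]
    simp [Finsupp.single_apply, Pi.single_apply, (evenIndex_injective hn).eq_iff, eq_comm]
  exact LinearMap.congr_fun this x

theorem evenBasis_repr_mul (i j k : Fin ((n - 1) / 2 + 1)) :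
    (evenBasis hn).repr (evenBasis hn i * evenBasis hn j) k =
      pathCheb hn (2 * i) (evenIndex hn k) (evenIndex hn j) := by
  rw [evenBasis_repr, evenBasis_apply, evenBasis_apply]
  change verlindeCoord hn (verlindeDelta n (2 * i) * verlindeDelta n (evenIndex hn j)) _ = _
  rw [verlindeCoord_mul_delta, verlindeRegular_delta]

/-- The even part of the Verlinde ring as a fusion ring. -/
def evenFusion :
    FusionRing (verlindeEven n) (Fin ((n - 1) / 2 + 1)) where
  basis := evenBasis hn
  unit := 0
  star i := i
  basis_unit := by
    rw [evenBasis_apply]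
    exact Subtype.ext verlindeDelta_zero
  nonneg i j k := by
    rw [evenBasis_repr_mul]
    exact pathCheb_nonneg hn (by omega) _ _
  star_star _ := rfl
  star_anti := ⟨RingEquiv.toOpposite _, fun _ => rfl⟩
  unit_coeff i j := by
    rw [evenBasis_repr_mul, pathCheb_apply_comm]
    have := congrFun (pathCheb_apply_zero hn (2 * i) (by omega)) (evenIndex hn j)
    refine this.trans ?_
    simp [Pi.single_apply, evenIndex, Fin.ext_iff, eq_comm]

end Path

end

/-! ### The action on `M_Γ`, its fixed points, and the main theorem -/

noncomputable section
open Matrix Polynomial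

namespace ADEDiagram.HasPerronVector

variable {Γ : ADEDiagram} {v : Γ.V} {n : ℕ} (H : Γ.HasPerronVector (n + 1) v)

include H in
theorem one_le : 1 ≤ n := by
  have := H.two_le
  omega

/-- The character of the Verlinde ring with value `2 cos (π / h)` at `Δ_1`. -/
def character : VerlindeRing n →+* ℝ :=
  verlindeLift (2 * Real.cos (Real.pi / (n + 1 : ℕ))) (by
    have h := eval_S_pred_eq_zero H.two_le
    push_cast at h ⊢
    rw [add_sub_cancel_right] at h
    rw [← h]
    simp)

theorem character_delta (k : ℕ) : H.character (verlindeDelta n k) =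
    (Chebyshev.S ℝ k).eval (2 * Real.cos (Real.pi / (n + 1 : ℕ))) := by
  rw [character, verlindeLift_delta]
  simp

/-- The action of the Verlinde ring on `M_Γ`. -/
def action : VerlindeRing n →+* Matrix (Fin Γ.rank) (Fin Γ.rank) ℤ :=
  verlindeLift (Γ.graph.adjMatrix ℤ) H.aeval_eq_zero

/-- The restriction of the character to the even part. -/
def evenCharacter : verlindeEven n →+* ℝ := H.character.comp (verlindeEven n).subtype

theorem evenCharacter_basis (k : Fin ((n - 1) / 2 + 1)) :
    H.evenCharacter ((evenFusion H.one_le).basis k) =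
      (Chebyshev.S ℝ ((2 * k : ℕ) : ℤ)).eval (2 * Real.cos (Real.pi / (n + 1 : ℕ))) := by
  rw [← H.character_delta]
  exact congrArg (fun x : verlindeEven n => H.character x) (evenBasis_apply H.one_le k)

theorem evenCharacter_pos (k : Fin ((n - 1) / 2 + 1)) :
    0 < H.evenCharacter ((evenFusion H.one_le).basis k) := by
  rw [evenCharacter_basis]
  have := H.one_le
  exact eval_S_pos H.two_le (by omega)

/-- The hypergroup of the even part of the Verlinde ring. -/
def evenHypergroup : Hypergroup (ℝ ⊗[ℤ] verlindeEven n) (Fin ((n - 1) / 2 + 1)) :=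
  (evenFusion H.one_le).toHypergroup H.evenCharacter H.evenCharacter_pos fun _ => rfl

theorem evenHypergroup_basis (k : Fin ((n - 1) / 2 + 1)) :
    H.evenHypergroup.basis k = (H.evenCharacter ((evenFusion H.one_le).basis k))⁻¹ •
      ((1 : ℝ) ⊗ₜ[ℤ] (evenFusion H.one_le).basis k) :=
  (evenFusion H.one_le).normalizedBasis_apply _ H.evenCharacter_pos k

theorem extendScalars_evenHypergroup_basis (k : Fin ((n - 1) / 2 + 1)) :
    extendScalars (H.action.comp (verlindeEven n).subtype) (H.evenHypergroup.basis k) =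
      (H.evenCharacter ((evenFusion H.one_le).basis k))⁻¹ • Γ.chebMatrix (2 * k) := by
  rw [evenHypergroup_basis, map_smul, extendScalars_tmul, one_smul]
  have : (H.action.comp (verlindeEven n).subtype) ((evenFusion H.one_le).basis k) =
      aeval (Γ.graph.adjMatrix ℤ) (Chebyshev.S ℤ ((2 * k : ℕ) : ℤ)) := by
    refine Eq.trans ?_ (verlindeLift_delta _ H.aeval_eq_zero _)
    exact congrArg (fun x : verlindeEven n => H.action x) (evenBasis_apply H.one_le k)
  rw [this, map_aeval_adjMatrix]
  push_cast
  rfl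

-- Because `Δ_2 = x² - 1`, the condition for `Δ_2` is the eigenvalue condition for the square of the
-- adjacency matrix.
include H in
theorem mem_coxeterPlane_iff_chebMatrix_two {w : Γ.V} :
    w ∈ Γ.coxeterPlane ↔ Γ.chebMatrix 2 *ᵥ w =
      (Chebyshev.S ℝ 2).eval (2 * Real.cos (Real.pi / (n + 1 : ℕ))) • w := by
  rw [H.mem_coxeterPlane_iff, chebMatrix, Chebyshev.S_two, Chebyshev.S_two]
  simp only [map_sub, map_mul, aeval_X, map_one, sub_mulVec, one_mulVec, pow_two, eval_sub,
    eval_mul, eval_X, eval_one, sub_smul, one_smul, mulVec_mulVec, sub_left_inj]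

theorem fixedPoints_eq : H.evenHypergroup.fixedPoints
    (extendScalars (H.action.comp (verlindeEven n).subtype)) = Γ.coxeterPlane := by
  ext w
  have key : w ∈ H.evenHypergroup.fixedPoints
      (extendScalars (H.action.comp (verlindeEven n).subtype)) ↔
      ∀ k : Fin ((n - 1) / 2 + 1), Γ.chebMatrix (2 * k) *ᵥ w =
        (Chebyshev.S ℝ (2 * k)).eval (2 * Real.cos (Real.pi / (n + 1 : ℕ))) • w := by
    refine forall_congr' fun k => ?_
    have h1 := H.evenCharacter_pos k
    rw [extendScalars_evenHypergroup_basis, smul_mulVec, inv_smul_eq_iff₀ h1.ne',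
      evenCharacter_basis]
    push_cast
    rfl
  rw [key]
  refine ⟨fun hw => ?_, fun hw k => H.chebMatrix_even_mulVec hw k⟩
  rw [H.mem_coxeterPlane_iff_chebMatrix_two]
  have hzero := H.chebMatrix_pred_eq_zero
  have hzero' := eval_S_pred_eq_zero H.two_le
  -- For `n = 1, 2` the only basis element is `Δ_0`, so every vector is fixed and the plane must be
  -- everything: `Δ_2` takes the value `-1` (if `n = 1`) or `0` (if `n = 2`) both at the adjacency
  -- matrix and at `t`. For `n ≥ 3`, `Δ_2` is a basis element.
  rcases lt_or_ge n 3 with hn | hn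
  · have := H.one_le
    interval_cases n
    · norm_num at hzero hzero' ⊢
      have h2 : Γ.chebMatrix 2 = -1 := by
        have := Γ.chebMatrix_add_two 0
        rwa [zero_add, zero_add, chebMatrix_one, chebMatrix_zero, hzero, zero_mul,
          zero_sub] at this
      simp [h2, neg_mulVec, Chebyshev.S_two]
    · norm_num at hzero hzero' ⊢
      simp [hzero, hzero']
  · have := hw ⟨1, by omega⟩
    simpa using this

theorem isZPlusModule_action : (verlindeFusion H.one_le).IsZPlusModule H.action := by
  intro i k l
  have : H.action ((verlindeFusion H.one_le).basis i) =
      aeval (Γ.graph.adjMatrix ℤ) (Chebyshev.S ℤ (i : ℕ)) := by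
    refine Eq.trans ?_ (verlindeLift_delta _ H.aeval_eq_zero _)
    exact congrArg H.action (verlindeBasis_apply H.one_le i)
  rw [this]
  exact H.aeval_nonneg (by omega) k l

end ADEDiagram.HasPerronVector

end

/-- Let `Γ` be an ADE Dynkin diagram with Coxeter number `h`. The Verlinde ring `R_{h-1}` and its
even part are fusion rings (`F`, `E`) for the bases `Δ_k` and `Δ_{2k}`, the even part induces a
hypergroup `H` with basis `Δ_{2k} / FPdim(Δ_{2k})`, there is a `ℤ₊`-module `M_Γ` over `R_{h-1}` on
which `Δ_1` acts by the adjacency matrix (`ρ`), and the fixed points of the induced action of `H` on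
`V_Γ` are the Coxeter plane. The data `F`, `E`, `H`, `ρ` are uniquely determined by the stated
properties. The numbers `± 2 cos (π / h)` are simple eigenvalues of `2 I - 𝔄`, and the Coxeter plane
has dimension `2` if the rank is at least `2` (for `A 1`, `h = 2` and it is the line `V_Γ`). -/
theorem theorem4p1 (Γ : ADEDiagram) :
    ∃ (F : FusionRing (VerlindeRing (Γ.coxeterNumber - 1)) (Fin (Γ.coxeterNumber - 1)))
      (E : FusionRing (verlindeEven (Γ.coxeterNumber - 1))
        (Fin ((Γ.coxeterNumber - 1 - 1) / 2 + 1)))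
      (H : Hypergroup (ℝ ⊗[ℤ] verlindeEven (Γ.coxeterNumber - 1))
        (Fin ((Γ.coxeterNumber - 1 - 1) / 2 + 1)))
      (ρ : VerlindeRing (Γ.coxeterNumber - 1) →+* Matrix (Fin Γ.rank) (Fin Γ.rank) ℤ),
      (∀ k, F.basis k = verlindeDelta (Γ.coxeterNumber - 1) k) ∧
      (∀ k, (E.basis k : VerlindeRing (Γ.coxeterNumber - 1)) =
        verlindeDelta (Γ.coxeterNumber - 1) (2 * k)) ∧
      (∀ k, H.basis k = (E.FPdim k)⁻¹ • ((1 : ℝ) ⊗ₜ[ℤ] E.basis k)) ∧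
      ρ (verlindeDelta (Γ.coxeterNumber - 1) 1) = Γ.graph.adjMatrix ℤ ∧
      F.IsZPlusModule ρ ∧
      H.fixedPoints
        (extendScalars (ρ.comp (verlindeEven (Γ.coxeterNumber - 1)).subtype)) =
          Γ.coxeterPlane ∧
      Module.finrank ℝ (Γ.eigenspace (2 * Real.cos (Real.pi / (Γ.coxeterNumber : ℝ)))) = 1 ∧
      Module.finrank ℝ (Γ.eigenspace (-(2 * Real.cos (Real.pi / (Γ.coxeterNumber : ℝ))))) = 1 ∧
      (2 ≤ Γ.rank → Module.finrank ℝ Γ.coxeterPlane = 2) := by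
  obtain ⟨h, v, H⟩ := Γ.exists_hasPerronVector
  have hplane := H.finrank_coxeterPlane
  rw [H.coxeterNumber_eq]
  obtain ⟨n, rfl⟩ : ∃ n, h = n + 1 := ⟨h - 1, by have := H.two_le; omega⟩
  exact ⟨verlindeFusion H.one_le, evenFusion H.one_le, H.evenHypergroup, H.action,
    fun k => verlindeBasis_apply H.one_le k,
    fun k => congrArg Subtype.val (evenBasis_apply H.one_le k),
    fun k => by
      -- The hypergroup was normalised by the character; positivity identifies the character with
      -- `FPdim`.
      rw [(evenFusion H.one_le).FPdim_eq H.evenCharacter H.evenCharacter_pos]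
      exact H.evenHypergroup_basis k,
    (verlindeLift_delta _ H.aeval_eq_zero 1).trans (by simp),
    H.isZPlusModule_action, H.fixedPoints_eq, H.finrank_eigenspace, H.finrank_eigenspace_neg,
    hplane⟩
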